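/- Let $p$ be a prime, let $\Sigma_{p+1}$ be the symmetric group on $p+1$ letters, and let $V\cong(\mathbb{F}_p)^p$ be its natural module over $\mathbb{F}_p$, i.e. the $(p+1)$-dimensional permutation module $(\mathbb{F}_p)^{p+1}$ modulo the diagonal line of constant vectors. For a finite group $\Gamma$ and a Sylow $p$-subgroup $T$ of $\Gamma$, let $\mathcal{O}_T(\Gamma)$ be the category whose objects are the subgroups of $T$ and whose morphisms $P\to Q$ are the $\Gamma$-equivariant maps $\Gamma/P\to\Gamma/Q$. For an $\mathbb{F}_p\Gamma$-module $M$, let $F_M\colon\mathcal{O}_T(\Gamma)^{\mathrm{op}}\to\mathsf{Ab}$ be the functor with $F_M(1)=M$ and $F_M(P)=0$ for $P\neq1$, where a morphism $\Gamma/1\to\Gamma/1$, $g\mapsto ga$, induces $m\mapsto am$ on $F_M(1)=M$. Let $\Lambda^i(\Gamma;M)$ be the value at $F_M$ of the $i$-th right derived functor of the inverse limit functor on functors $\mathcal{O}_T(\Gamma)^{\mathrm{op}}\to\mathsf{Ab}$. Then, for every choice of Sylow $p$-subgroup $T$ of $\Sigma_{p+1}\times\Sigma_{p+1}\times\Sigma_{p+1}$,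 $$\Lambda^3(\Sigma_{p+1}\times\Sigma_{p+1}\times\Sigma_{p+1};\,V\otimes V\otimes V)\cong\mathbb{F}_p$$ as abelian groups, where the tensor products are over $\mathbb{F}_p$ and $(g_1,g_2,g_3)$ acts by $(g_1,g_2,g_3)(x\otimes y\otimes z)=g_1x\otimes g_2y\otimes g_3z$. -/

import Mathlib

open CategoryTheory CategoryTheory.Limits

universe u v

/-! ### Higher limits -/

section HigherLimits

variable (C : Type u) [Category.{u} C]

instance functorToAb_ab5 : AB5OfSize.{u, u} (Cᵒᵖ ⥤ AddCommGrpCat.{u}) where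
  ofShape K _ _ := by infer_instance

/-- Functors `Cᵒᵖ ⥤ Ab` form a Grothendieck abelian category; in particular there are
enough injectives. -/
instance functorToAb_isGrothendieckAbelian :
    IsGrothendieckAbelian.{u} (Cᵒᵖ ⥤ AddCommGrpCat.{u}) where

instance limFunctor_additive :
    (lim : (Cᵒᵖ ⥤ AddCommGrpCat.{u}) ⥤ AddCommGrpCat.{u}).Additive where
  map_add := by
    intros
    apply limit.hom_ext
    intros
    simp

variable {C}

/-- The `i`-th higher limit of `F : Cᵒᵖ ⥤ Ab`: the value at `F` of the `i`-th right derived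
functor of the inverse limit functor `(Cᵒᵖ ⥤ Ab) ⥤ Ab`. -/
noncomputable def higherLim (i : ℕ) (F : Cᵒᵖ ⥤ AddCommGrpCat.{u}) : AddCommGrpCat.{u} :=
  ((lim : (Cᵒᵖ ⥤ AddCommGrpCat.{u}) ⥤ AddCommGrpCat.{u}).rightDerived i).obj F

end HigherLimits

/-! ### Orbit categories -/

/-- The objects of the orbit category `𝒪_S(G)`: the subgroups `P ≤ S`. -/
@[ext]
structure OrbitCat {G : Type u} [Group G] (S : Subgroup G) : Type u where
  /-- the subgroup of `G` -/
  sub : Subgroup G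
  le : sub ≤ S

namespace OrbitCat

variable {G : Type u} [Group G] {S : Subgroup G}

/-- Morphisms `P ⟶ Q` in `𝒪_S(G)` are the `G`-equivariant maps `G/P → G/Q`. -/
instance : Category.{u} (OrbitCat S) where
  Hom P Q := (G ⧸ P.sub) →[G] (G ⧸ Q.sub)
  id P := MulActionHom.id G
  comp f g := MulActionHom.comp g f

/-- A `G`-equivariant map `φ : G/P → G/Q`. -/
def toMap {P Q : OrbitCat S} (φ : P ⟶ Q) : (G ⧸ P.sub) →[G] (G ⧸ Q.sub) := φ

/-- An element `a` such that `φ(gP) = gaQ` for all `g`; it is unique if `Q = 1`. -/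
noncomputable def rep {P Q : OrbitCat S} (φ : P ⟶ Q) : G :=
  (toMap φ ((1 : G) : G ⧸ P.sub)).out

theorem toMap_mk {P Q : OrbitCat S} (φ : P ⟶ Q) (g : G) :
    toMap φ (g : G ⧸ P.sub) = ((g * rep φ : G) : G ⧸ Q.sub) := by
  have h1 : (g : G ⧸ P.sub) = g • ((1 : G) : G ⧸ P.sub) := by
    rw [MulAction.Quotient.smul_coe, smul_eq_mul, mul_one]
  have h2 : ((rep φ : G) : G ⧸ Q.sub) = toMap φ ((1 : G) : G ⧸ P.sub) :=
    Quotient.out_eq' _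
  rw [h1, map_smul, ← h2, MulAction.Quotient.smul_coe, smul_eq_mul]

/-- If there is a morphism `P ⟶ Q` with `Q = 1`, then `P = 1`. -/
theorem sub_eq_bot_of_hom {P Q : OrbitCat S} (φ : P ⟶ Q) (hQ : Q.sub = ⊥) : P.sub = ⊥ := by
  rw [Subgroup.eq_bot_iff_forall]
  intro x hx
  have h : ((x * rep φ : G) : G ⧸ Q.sub) = ((1 * rep φ : G) : G ⧸ Q.sub) := by
    rw [← toMap_mk, ← toMap_mk]
    congr 1
    rw [QuotientGroup.eq]
    simpa using hx
  rw [QuotientGroup.eq, hQ, Subgroup.mem_bot] at h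
  have h' := inv_mul_eq_one.mp h
  simpa using h'

theorem rep_id {P : OrbitCat S} (hP : P.sub = ⊥) : rep (𝟙 P) = 1 := by
  have h := toMap_mk (𝟙 P) 1
  have h' : toMap (𝟙 P) ((1 : G) : G ⧸ P.sub) = ((1 : G) : G ⧸ P.sub) := rfl
  rw [h', QuotientGroup.eq, hP, Subgroup.mem_bot] at h
  simpa using h

theorem rep_comp {P Q R : OrbitCat S} (φ : P ⟶ Q) (ψ : Q ⟶ R) (hR : R.sub = ⊥) :
    rep (φ ≫ ψ) = rep φ * rep ψ := by
  have h := toMap_mk (φ ≫ ψ) 1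
  have h' : toMap (φ ≫ ψ) ((1 : G) : G ⧸ P.sub) = toMap ψ (toMap φ ((1 : G) : G ⧸ P.sub)) := rfl
  rw [h', toMap_mk, toMap_mk, QuotientGroup.eq, hR, Subgroup.mem_bot, inv_mul_eq_one] at h
  simpa using h.symm

end OrbitCat

/-! ### The functors `F_M` and the groups `Λ^i(Γ; M)` -/

section Lambda

variable {k : Type v} [CommRing k] {Γ : Type u} [Group Γ] {M : Type u} [AddCommGroup M]
  [Module k M]

open Classical in
/-- The value of `F_M` at `P`, as a subgroup of `M`: it is `M` if `P = 1`, and `0` if `P ≠ 1`. -/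
noncomputable def atomicVal (M : Type u) [AddCommGroup M] (P : Subgroup Γ) : AddSubgroup M :=
  if P = ⊥ then ⊤ else ⊥

theorem eq_zero_of_mem_atomicVal {P : Subgroup Γ} (hP : P ≠ ⊥) {m : M}
    (hm : m ∈ atomicVal M P) : m = 0 := by
  simpa [atomicVal, hP] using hm

theorem smul_mem_atomicVal (ρ : Representation k Γ M) {S : Subgroup Γ} {P Q : OrbitCat S}
    (φ : P ⟶ Q) {m : M} (hm : m ∈ atomicVal M Q.sub) :
    ρ (OrbitCat.rep φ) m ∈ atomicVal M P.sub := by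
  by_cases hQ : Q.sub = ⊥
  · simp [atomicVal, OrbitCat.sub_eq_bot_of_hom φ hQ]
  · rw [eq_zero_of_mem_atomicVal hQ hm, map_zero]
    exact zero_mem _

/-- The map `F_M(Q) → F_M(P)` induced by the morphism `gP ↦ gaQ` from `P` to `Q`:
it is `m ↦ a m`. -/
noncomputable def atomicMap (ρ : Representation k Γ M) {S : Subgroup Γ} {P Q : OrbitCat S}
    (φ : P ⟶ Q) : atomicVal M Q.sub →+ atomicVal M P.sub where
  toFun m := ⟨ρ (OrbitCat.rep φ) m, smul_mem_atomicVal ρ φ m.2⟩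
  map_zero' := by ext; simp
  map_add' x y := by ext; simp

/-- The functor `F_M : 𝒪_S(Γ)ᵒᵖ ⥤ Ab` with `F_M(1) = M`, on which `Aut(1) ≅ Γ` has the given
action, and `F_M(P) = 0` for `P ≠ 1`. -/
noncomputable def atomicFunctor (S : Subgroup Γ) (ρ : Representation k Γ M) :
    (OrbitCat S)ᵒᵖ ⥤ AddCommGrpCat.{u} where
  obj P := AddCommGrpCat.of (atomicVal M P.unop.sub)
  map φ := AddCommGrpCat.ofHom (atomicMap ρ φ.unop)
  map_id P := by
    ext ⟨m, hm⟩
    change ρ (OrbitCat.rep (𝟙 P.unop)) m = m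
    by_cases hP : P.unop.sub = ⊥
    · simp [OrbitCat.rep_id hP]
    · rw [eq_zero_of_mem_atomicVal hP hm, map_zero]
  map_comp {P Q R} φ ψ := by
    ext ⟨m, hm⟩
    change ρ (OrbitCat.rep (ψ.unop ≫ φ.unop)) m =
      ρ (OrbitCat.rep ψ.unop) (ρ (OrbitCat.rep φ.unop) m)
    by_cases hP : P.unop.sub = ⊥
    · simp [OrbitCat.rep_comp _ _ hP]
    · rw [eq_zero_of_mem_atomicVal hP hm, map_zero, map_zero, map_zero]

/-- `Λ^i(Γ; M)`, computed with the Sylow `p`-subgroup `T` of `Γ`: the `i`-th higher limit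
of `F_M` over `𝒪_T(Γ)`. -/
noncomputable def Lambda {p : ℕ} (T : Sylow p Γ) (ρ : Representation k Γ M) (i : ℕ) :
    AddCommGrpCat.{u} :=
  higherLim i (atomicFunctor (T : Subgroup Γ) ρ)

end Lambda

/-! ### The representations -/

/-- The permutation representation of `Σ_n` on `k^n`: `(σ f)(j) = f(σ⁻¹ j)`. -/
def permRep (k : Type u) [CommRing k] (n : ℕ) :
    Representation k (Equiv.Perm (Fin n)) (Fin n → k) where
  toFun σ := LinearMap.funLeft k k (σ⁻¹ : Equiv.Perm (Fin n))
  map_one' := by ext; simp [LinearMap.funLeft_apply]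
  map_mul' σ τ := by ext; simp [LinearMap.funLeft_apply]

/-- The diagonal in `(F_p)^(p+1)`: the line of constant vectors. -/
def diagonalLine (p : ℕ) : Submodule (ZMod p) (Fin (p + 1) → ZMod p) :=
  Submodule.span (ZMod p) {fun _ => 1}

theorem diagonalLine_le_comap (p : ℕ) (σ : Equiv.Perm (Fin (p + 1))) :
    diagonalLine p ≤ (diagonalLine p).comap (permRep (ZMod p) (p + 1) σ) := by
  rw [diagonalLine, Submodule.span_le, Set.singleton_subset_iff]
  exact Submodule.subset_span rfl

/-- The natural module `V` for `Σ_{p+1}` over `F_p`: the `(p+1)`-dimensional permutation module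
modulo the diagonal. -/
abbrev NatMod (p : ℕ) : Type := (Fin (p + 1) → ZMod p) ⧸ diagonalLine p

/-- The action of `Σ_{p+1}` on its natural module. -/
noncomputable def natRep (p : ℕ) : Representation (ZMod p) (Equiv.Perm (Fin (p + 1))) (NatMod p) :=
  (permRep (ZMod p) (p + 1)).quotient (diagonalLine p) (diagonalLine_le_comap p)

/-- `V ≅ (F_p)^p` as a vector space. -/
theorem finrank_natMod (p : ℕ) [Fact p.Prime] : Module.finrank (ZMod p) (NatMod p) = p := by
  have h := Submodule.finrank_quotient_add_finrank (diagonalLine p)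
  have h1 : Module.finrank (ZMod p) (diagonalLine p) = 1 :=
    finrank_span_singleton (fun h0 => one_ne_zero (congrFun h0 0))
  rw [h1, Module.finrank_fin_fun] at h
  exact Nat.succ_injective h

/-- The `G × H`-module `V ⊗ W` with `(g, h)(x ⊗ y) = gx ⊗ hy`. -/
noncomputable def outerTensor {k G H V W : Type*} [CommRing k] [Group G] [Group H]
    [AddCommGroup V] [Module k V] [AddCommGroup W] [Module k W]
    (ρ : Representation k G V) (σ : Representation k H W) :
    Representation k (G × H) (TensorProduct k V W) :=
  Representation.tprod (MonoidHom.comp ρ (MonoidHom.fst G H))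
    (MonoidHom.comp σ (MonoidHom.snd G H))

/-! Put G = Σ_{p+1}, Γ = G³, Y = Syl_p(G), M = V⊗V⊗V and F = F_M. Higher limits in positive degree
are Ext groups out of the constant functor ℤ, so Λ³ = Ext³(ℤ, F) in the category of functors on the
orbit category (`higherLim_succ_nonempty_addEquiv`). To a Γ-set Ω attach the functor that sends P to
the integral functions supported on Ω^P. For Ω = Γ/Q this is the free abelian functor on the object
Q, so it is projective and its morphisms to F form F(Q), which is 0 for Q ≠ 1. Since p kills F,
integers prime to p may be inverted, and a transfer argument extends the vanishing of Ext into F to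
every finite Ω each of whose points is fixed by a largest p-subgroup that is nontrivial
(`extVanish_supported`).

Let I be the functions on Y with sum zero. Every p-subgroup of G fixes a Sylow subgroup, so 0 → I →
ℤ[Y] → ℤ → 0 is exact as a sequence of functors, and it can be used in each of three variables. A
functor with ℤ[Y] in some variable has no Ext into F (`extVanish_kindTens`): a variable of type ℤ is
removed by the same sequence, and one of type I by noting that I is, up to the factor |Y| prime to
p, a direct summand of ℤ[Y × Y]. The latter uses that distinct Sylow subgroups, being of order p,
meet trivially. What remains is a permutation functor, and the variable of type ℤ[Y] keeps the
fixing subgroups nontrivial. Three dimension shifts give Λ³ ≅ Hom(I⊗I⊗I, F)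
(`higherLim_three_nonempty_addEquiv`).

As I⊗I⊗I vanishes at every P ≠ 1 (`sumZero_eq_zero`), these are the equivariant maps from I⊗I⊗I to
M. The vectors 1 - |Y|δ_a generate I up to the factor |Y|, and G permutes them transitively; hence a
map is determined by its value at the triple tensor of one such vector, which is invariant under y ×
y × y for the Sylow subgroup y = a. Now y permutes a basis of V transitively, so the invariants in M
form a line, and one coordinate embeds Hom into 𝔽_p (`devCoord_injective`). Sending each Sylow
subgroup to the basis vector of its fixed letter gives a nonzero map (`sylowHom_ne_zero`), so the
embedding is onto. -/

section

open CategoryTheory.Abelian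
open scoped Pointwise TensorProduct

/-! ### Vanishing of `Ext` -/

section ExtVanishing

variable {A : Type*} [Category* A] [Abelian A] [HasExt.{v} A]

/-- `Ext^n(D, F) = 0` for all `n`. -/
def ExtVanish (D F : A) : Prop :=
  ∀ (n : ℕ) (x : Ext D F n), x = 0

theorem ExtVanish.of_shortExact {S : ShortComplex A} (hS : S.ShortExact) {F : A}
    (h₁ : ExtVanish S.X₁ F) (h₂ : ExtVanish S.X₂ F) : ExtVanish S.X₃ F := by
  rintro (_ | n) x
  · have := hS.epi_g
    apply Ext.precomp_mk₀_injective_of_epi F S.g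
    exact (h₂ 0 _).trans (h₂ 0 _).symm
  · obtain ⟨y, rfl⟩ := Ext.contravariant_sequence_exact₃ hS F x (h₂ _ _) (add_comm 1 n)
    rw [h₁ n y]
    simp

/-- Dimension shifting along a short exact sequence with `Ext^n(S.X₂, F) = 0`. -/
theorem ExtVanish.nonempty_addEquiv {S : ShortComplex A} (hS : S.ShortExact) {F : A}
    (h₂ : ExtVanish S.X₂ F) (n : ℕ) : Nonempty (Ext S.X₁ F n ≃+ Ext S.X₃ F (n + 1)) := by
  refine ⟨AddEquiv.ofBijective (hS.extClass.precomp F (add_comm 1 n)) ⟨?_, ?_⟩⟩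
  · rw [injective_iff_map_eq_zero]
    intro x hx
    obtain ⟨y, rfl⟩ := Ext.contravariant_sequence_exact₁ hS F x (add_comm 1 n) hx
    rw [h₂ n y]
    simp
  · intro x
    exact Ext.contravariant_sequence_exact₃ hS F x (h₂ _ _) (add_comm 1 n)

theorem ExtVanish.of_projective {D F : A} [Projective D] (h : ∀ f : D ⟶ F, f = 0) :
    ExtVanish D F := by
  rintro (_ | n) x
  · obtain ⟨f, rfl⟩ := (Ext.mk₀_bijective D F).2 x
    rw [h f]
    simp
  · exact Ext.eq_zero_of_projective x

/-- If `p` kills `F` and a multiple of the identity of `D` that is prime to `p` factors through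
objects without `Ext` into `F`, then there is no `Ext` from `D` to `F`. -/
theorem ExtVanish.of_sum_comp {D F : A} {p : ℕ} (hF : (p : ℤ) • 𝟙 F = 0) {m : ℤ}
    (hm : IsCoprime m p) {J : Type*} (t : Finset J) (E : J → A) (s : ∀ j, D ⟶ E j)
    (r : ∀ j, E j ⟶ D) (h : ∑ j ∈ t, s j ≫ r j = m • 𝟙 D) (hE : ∀ j ∈ t, ExtVanish (E j) F) :
    ExtVanish D F := by
  intro n x
  -- Composition is biadditive: m • x is a sum of classes that pass through the vanishing groups of
  -- the `E j`. The action of p on x can instead be moved to `F`, where it is zero.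
  have h1 : m • x = 0 := by
    let c : (D ⟶ D) →+ Ext D F n :=
      { toFun f := (Ext.mk₀ f).comp x (zero_add n)
        map_zero' := by simp
        map_add' f g := by rw [Ext.mk₀_add, Ext.add_comp] }
    have h2 : c (∑ j ∈ t, s j ≫ r j) = 0 := by
      rw [map_sum]
      refine Finset.sum_eq_zero fun j hj => ?_
      change (Ext.mk₀ (s j ≫ r j)).comp x (zero_add n) = 0
      rw [← Ext.mk₀_comp_mk₀_assoc, hE j hj _ ((Ext.mk₀ (r j)).comp x (zero_add n))]
      simp
    rw [h, map_zsmul] at h2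
    simpa [c] using h2
  have h4 : (p : ℤ) • x = 0 := by
    let c : (F ⟶ F) →+ Ext D F n :=
      { toFun f := x.comp (Ext.mk₀ f) (add_zero n)
        map_zero' := by simp
        map_add' f g := by rw [Ext.mk₀_add, Ext.comp_add] }
    have h2 := congrArg c hF
    rw [map_zsmul, map_zero] at h2
    simpa [c] using h2
  obtain ⟨a, b, hab⟩ := hm
  calc x = (a * m + b * p) • x := by rw [hab, one_smul]
    _ = 0 := by rw [add_smul, mul_smul, mul_smul, h1, h4]; simp

/-- `Ext` groups of isomorphic objects are isomorphic. -/
noncomputable def extAddEquivOfIso {D D' : A} (e : D ≅ D') (F : A) (n : ℕ) :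
    Ext D' F n ≃+ Ext D F n where
  toFun x := (Ext.mk₀ e.hom).comp x (zero_add n)
  invFun x := (Ext.mk₀ e.inv).comp x (zero_add n)
  left_inv x := by
    beta_reduce
    rw [Ext.mk₀_comp_mk₀_assoc]
    simp
  right_inv x := by
    beta_reduce
    rw [Ext.mk₀_comp_mk₀_assoc]
    simp
  map_add' x y := by simp

theorem ExtVanish.of_iso {D D' F : A} (e : D ≅ D') (h : ExtVanish D' F) : ExtVanish D F := by
  intro n x
  rw [← (extAddEquivOfIso e F n).apply_symm_apply x,
    h n ((extAddEquivOfIso e F n).symm x), map_zero]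

end ExtVanishing

/-! ### Higher limits as `Ext` groups -/

section HigherLimExt

variable {C : Type} [Category.{0} C]

/-- The constant functor `ℤ`. -/
noncomputable def constInt (C : Type) [Category.{0} C] : Cᵒᵖ ⥤ AddCommGrpCat.{0} :=
  (Functor.const Cᵒᵖ).obj (AddCommGrpCat.of ℤ)

/-- Elements of the limit are morphisms from the constant functor `ℤ`. -/
noncomputable def limToHom (F : Cᵒᵖ ⥤ AddCommGrpCat.{0}) :
    ((lim : (Cᵒᵖ ⥤ AddCommGrpCat.{0}) ⥤ _).obj F : Type) →+ (constInt C ⟶ F) where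
  toFun x := (constLimAdj.homEquiv (AddCommGrpCat.of ℤ) F).symm
    (AddCommGrpCat.ofHom (zmultiplesAddHom _ x))
  map_zero' := by
    rw [map_zero]
    exact (constLimAdj.homAddEquiv _ F).symm.map_zero
  map_add' x y := by
    rw [map_add]
    exact (constLimAdj.homAddEquiv _ F).symm.map_add _ _

theorem limToHom_bijective (F : Cᵒᵖ ⥤ AddCommGrpCat.{0}) : Function.Bijective (limToHom F) := by
  refine (Equiv.bijective (constLimAdj.homEquiv (AddCommGrpCat.of ℤ) F).symm).comp
    ⟨fun x y h => ?_, fun f => ⟨f (1 : ℤ), ?_⟩⟩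
  · have := ConcreteCategory.congr_hom h (1 : ℤ)
    simpa using this
  · ext
    simp

theorem limToHom_naturality {F F' : Cᵒᵖ ⥤ AddCommGrpCat.{0}} (g : F ⟶ F')
    (x : (lim : (Cᵒᵖ ⥤ AddCommGrpCat.{0}) ⥤ _).obj F) :
    limToHom F' (lim.map g x) = limToHom F x ≫ g := by
  refine Eq.trans ?_ (constLimAdj.homEquiv_naturality_right_symm _ g)
  change (constLimAdj.homEquiv (AddCommGrpCat.of ℤ) F').symm _ = _
  congr 1
  ext
  simp

/-- Both sides are computed from one injective resolution of `F`: since lim = Hom(ℤ, –), cycles and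
boundaries of the limit complex are the morphisms ℤ → R^(n+1) that represent Ext classes and those
that represent zero. -/
theorem higherLim_succ_nonempty_addEquiv (F : Cᵒᵖ ⥤ AddCommGrpCat.{0}) (n : ℕ) :
    Nonempty (higherLim (n + 1) F ≃+ Ext (constInt C) F (n + 1)) := by
  let R := injectiveResolution F
  let K := ((lim : (Cᵒᵖ ⥤ AddCommGrpCat.{0}) ⥤ _).mapHomologicalComplex _).obj R.cocomplex
  have e₁ : higherLim (n + 1) F ≅ K.homology (n + 1) := R.isoRightDerivedObj lim (n + 1)
  have e₂ : K.homology (n + 1) ≅ (K.sc' n (n + 1) (n + 2)).homology :=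
    ShortComplex.homologyMapIso (K.isoSc' n (n + 1) (n + 2) (by simp) (by simp))
  have e₃ := (K.sc' n (n + 1) (n + 2)).abHomologyIso
  let d := (lim : (Cᵒᵖ ⥤ AddCommGrpCat.{0}) ⥤ _).map (R.cocomplex.d (n + 1) (n + 2))
  have hd (x : d.hom.ker) : limToHom _ x.1 ≫ R.cocomplex.d (n + 1) (n + 2) = 0 := by
    rw [← limToHom_naturality]
    exact (congrArg (limToHom _) x.2).trans (map_zero _)
  let θ : d.hom.ker →+ Ext (constInt C) F (n + 1) :=
    { toFun x := R.extMk (limToHom _ x.1) (n + 2) rfl (hd x)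
      map_zero' := by simp
      map_add' x y := by
        rw [R.add_extMk]
        congr 1
        exact map_add _ _ _ }
  have hθ : Function.Surjective θ := by
    intro x
    obtain ⟨f, hf, rfl⟩ := R.extMk_surjective x (n + 2) rfl
    obtain ⟨y, rfl⟩ := (limToHom_bijective _).2 f
    refine ⟨⟨y, ?_⟩, rfl⟩
    rw [← limToHom_naturality] at hf
    exact (limToHom_bijective _).1 (hf.trans (map_zero _).symm)
  have hker : θ.ker = (K.sc' n (n + 1) (n + 2)).abToCycles.range := by
    ext x
    rw [AddMonoidHom.mem_ker]
    change R.extMk _ (n + 2) rfl (hd x) = 0 ↔ _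
    rw [R.extMk_eq_zero_iff _ _ _ _ n rfl]
    constructor
    · rintro ⟨g, hg⟩
      obtain ⟨y, rfl⟩ := (limToHom_bijective _).2 g
      rw [← limToHom_naturality] at hg
      exact ⟨y, Subtype.ext ((limToHom_bijective _).1 hg)⟩
    · rintro ⟨y, rfl⟩
      exact ⟨limToHom _ y, (limToHom_naturality _ _).symm⟩
  exact ⟨(e₁ ≪≫ e₂ ≪≫ e₃).addCommGroupIsoToAddEquiv.trans
    ((QuotientAddGroup.quotientAddEquivOfEq (G := d.hom.ker) (M := AddMonoidHom.range _)
      (N := θ.ker) hker.symm).trans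
      (QuotientAddGroup.quotientKerEquivOfSurjective θ hθ))⟩

end HigherLimExt

/-! ### Lattices of integral functions on sets with a group action -/

namespace OrbitCat

variable {G : Type u} [Group G] {S : Subgroup G}

theorem rep_conj_mem {P Q : OrbitCat S} (φ : P ⟶ Q) {g : G} (hg : g ∈ P.sub) :
    (rep φ)⁻¹ * g * rep φ ∈ Q.sub := by
  have h : ((g * rep φ : G) : G ⧸ Q.sub) = ((1 * rep φ : G) : G ⧸ Q.sub) := by
    rw [← toMap_mk, ← toMap_mk]
    congr 1
    rw [QuotientGroup.eq]
    simpa using hg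
  have h' := QuotientGroup.eq.mp h.symm
  simpa [mul_assoc] using h'

/-- The representative `rep` is a choice, determined only up to right multiplication by the target
subgroup, so it is multiplicative only modulo that subgroup. -/
theorem rep_comp_mem {P Q R : OrbitCat S} (φ : P ⟶ Q) (ψ : Q ⟶ R) :
    (rep (φ ≫ ψ))⁻¹ * (rep φ * rep ψ) ∈ R.sub := by
  have h := toMap_mk (φ ≫ ψ) 1
  have h' : toMap (φ ≫ ψ) ((1 : G) : G ⧸ P.sub) = toMap ψ (toMap φ ((1 : G) : G ⧸ P.sub)) := rfl
  rw [h', toMap_mk, toMap_mk] at h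
  simpa using QuotientGroup.eq.mp h.symm

theorem rep_id_mem (P : OrbitCat S) : (rep (𝟙 P)) ∈ P.sub := by
  have h := toMap_mk (𝟙 P) 1
  have h' : toMap (𝟙 P) ((1 : G) : G ⧸ P.sub) = ((1 : G) : G ⧸ P.sub) := rfl
  rw [h'] at h
  simpa using QuotientGroup.eq.mp h

/-- The morphism `gP ↦ gaQ`, for `a` with `a⁻¹Pa ≤ Q`. -/
def homOfConj {P Q : OrbitCat S} (a : G) (ha : ∀ g ∈ P.sub, a⁻¹ * g * a ∈ Q.sub) : P ⟶ Q :=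
  (show (G ⧸ P.sub) →[G] (G ⧸ Q.sub) from
  { toFun := Quotient.lift (fun g => ((g * a : G) : G ⧸ Q.sub)) (by
      intro x y hxy
      refine QuotientGroup.eq.mpr ?_
      have := ha _ (QuotientGroup.leftRel_apply.mp hxy)
      simpa [mul_assoc] using this)
    map_smul' := by
      rintro g ⟨x⟩
      exact congrArg (fun z : G => (z : G ⧸ Q.sub)) (mul_assoc g x a) })

theorem toMap_homOfConj {P Q : OrbitCat S} (a : G) (ha : ∀ g ∈ P.sub, a⁻¹ * g * a ∈ Q.sub) :
    toMap (homOfConj a ha) ((1 : G) : G ⧸ P.sub) = (a : G ⧸ Q.sub) :=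
  congrArg (fun z : G => (z : G ⧸ Q.sub)) (one_mul a)

theorem hom_ext_one {P Q : OrbitCat S} {φ ψ : P ⟶ Q}
    (h : toMap φ ((1 : G) : G ⧸ P.sub) = toMap ψ ((1 : G) : G ⧸ P.sub)) : φ = ψ := by
  apply MulActionHom.ext
  rintro ⟨g⟩
  have hg : (Quot.mk _ g : G ⧸ P.sub) = g • ((1 : G) : G ⧸ P.sub) := by
    rw [MulAction.Quotient.smul_coe, smul_eq_mul, mul_one]; rfl
  change toMap φ (Quot.mk _ g) = toMap ψ (Quot.mk _ g)
  rw [hg, map_smul, map_smul, h]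

end OrbitCat

/-- A subgroup of the group of integral functions on a `Γ`-set that is stable under `Γ`. -/
@[ext]
structure PermLattice (Γ Ω : Type) [Group Γ] [MulAction Γ Ω] where
  /-- the subgroup -/
  sub : AddSubgroup (Ω → ℤ)
  comp_smul_mem : ∀ (g : Γ) (f : Ω → ℤ), f ∈ sub → (fun x => f (g • x)) ∈ sub

namespace PermLattice

variable {Γ : Type} [Group Γ] {Ω Ω' Ω'' : Type} [MulAction Γ Ω] [MulAction Γ Ω'] [MulAction Γ Ω'']

/-- The functions in the lattice that are supported on the fixed points of `P`. -/
def fixSub (B : PermLattice Γ Ω) (P : Subgroup Γ) : AddSubgroup (Ω → ℤ) where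
  carrier := {f | f ∈ B.sub ∧ ∀ x, f x ≠ 0 → ∀ g ∈ P, g • x = x}
  zero_mem' := ⟨B.sub.zero_mem, fun x hx => (hx rfl).elim⟩
  add_mem' {f f'} hf hf' := by
    refine ⟨B.sub.add_mem hf.1 hf'.1, fun x hx => ?_⟩
    by_cases h : f x = 0
    · exact hf'.2 x fun h' => hx (by simp [h, h'])
    · exact hf.2 x h
  neg_mem' {f} hf := ⟨B.sub.neg_mem hf.1, fun x hx => hf.2 x fun h => hx (by simp [h])⟩

/-- This invariance makes translation by `rep` independent of the chosen representative, and hence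
functorial. -/
theorem apply_smul_of_mem_fixSub {B : PermLattice Γ Ω} {P : Subgroup Γ} {f : Ω → ℤ}
    (hf : f ∈ B.fixSub P) {g : Γ} (hg : g ∈ P) (x : Ω) : f (g • x) = f x := by
  by_cases h : f x = 0
  · by_contra h'
    have h1 := hf.2 (g • x) (fun h2 => h' (h2.trans h.symm)) g⁻¹ (inv_mem hg)
    rw [inv_smul_smul] at h1
    exact h' (by rw [← h1])
  · rw [hf.2 x h g hg]

theorem comp_inv_smul_mem_fixSub {B : PermLattice Γ Ω} {P Q : Subgroup Γ} {a : Γ}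
    (ha : ∀ g ∈ P, a⁻¹ * g * a ∈ Q) {f : Ω → ℤ} (hf : f ∈ B.fixSub Q) :
    (fun x => f (a⁻¹ • x)) ∈ B.fixSub P := by
  refine ⟨B.comp_smul_mem _ _ hf.1, fun x hx g hg => ?_⟩
  have h := hf.2 _ hx _ (ha g hg)
  rwa [mul_smul, smul_inv_smul, mul_smul, smul_left_cancel_iff] at h

variable (S : Subgroup Γ)

/-- The functor on the orbit category that sends `P` to the functions in the lattice that
are supported on the fixed points of `P`. -/
noncomputable def functor (B : PermLattice Γ Ω) : (OrbitCat S)ᵒᵖ ⥤ AddCommGrpCat.{0} where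
  obj P := AddCommGrpCat.of (B.fixSub P.unop.sub)
  map φ := AddCommGrpCat.ofHom
    { toFun f := ⟨fun x => f.1 ((OrbitCat.rep φ.unop)⁻¹ • x),
        comp_inv_smul_mem_fixSub (fun _ hg => OrbitCat.rep_conj_mem φ.unop hg) f.2⟩
      map_zero' := rfl
      map_add' _ _ := rfl }
  map_id P := by
    ext f x
    exact apply_smul_of_mem_fixSub f.2 (inv_mem (OrbitCat.rep_id_mem P.unop)) x
  map_comp {P Q R} φ ψ := by
    ext f x
    change f.1 ((OrbitCat.rep (ψ.unop ≫ φ.unop))⁻¹ • x) =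
      f.1 ((OrbitCat.rep φ.unop)⁻¹ • (OrbitCat.rep ψ.unop)⁻¹ • x)
    have h := OrbitCat.rep_comp_mem ψ.unop φ.unop
    rw [← apply_smul_of_mem_fixSub f.2 h ((OrbitCat.rep φ.unop)⁻¹ • (OrbitCat.rep ψ.unop)⁻¹ • x)]
    simp [smul_smul, mul_assoc]

/-- An additive `Γ`-equivariant map between functions, compatible with lattices and fixed
points. -/
structure Hom (B : PermLattice Γ Ω) (B' : PermLattice Γ Ω') where
  /-- the underlying additive map -/
  toFun : (Ω → ℤ) →+ (Ω' → ℤ)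
  map_comp_smul : ∀ (g : Γ) (f : Ω → ℤ), toFun (fun x => f (g • x)) = fun x => toFun f (g • x)
  mem : ∀ P ≤ S, ∀ f ∈ B.fixSub P, toFun f ∈ B'.fixSub P

variable {S} {B : PermLattice Γ Ω} {B' : PermLattice Γ Ω'} {B'' : PermLattice Γ Ω''}

/-- The natural transformation induced by an equivariant map. -/
noncomputable def Hom.natTrans (h : Hom S B B') : B.functor S ⟶ B'.functor S where
  app P := AddCommGrpCat.ofHom
    { toFun f := ⟨h.toFun f.1, h.mem _ P.unop.le _ f.2⟩
      map_zero' := Subtype.ext (map_zero h.toFun)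
      map_add' f f' := Subtype.ext (map_add h.toFun f.1 f'.1) }
  naturality P Q φ := by
    ext f
    apply Subtype.ext
    exact h.map_comp_smul _ _

theorem functor_hom_ext {F : (OrbitCat S)ᵒᵖ ⥤ AddCommGrpCat.{0}} {α β : F ⟶ B.functor S}
    (h : ∀ P (x : F.obj P), (show B.fixSub P.unop.sub from α.app P x).1 =
      (show B.fixSub P.unop.sub from β.app P x).1) : α = β := by
  ext P x
  exact Subtype.ext (h P x)

/-- Pointwise criterion for a sequence of lattice functors to be short exact. -/
theorem shortExact (f : Hom S B B') (g : Hom S B' B'')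
    (hf : Function.Injective f.toFun)
    (hfg : ∀ x ∈ B.sub, g.toFun (f.toFun x) = 0)
    (hex : ∀ P ≤ S, ∀ y ∈ B'.fixSub P, g.toFun y = 0 → ∃ x ∈ B.fixSub P, f.toFun x = y)
    (hg : ∀ P ≤ S, ∀ z ∈ B''.fixSub P, ∃ y ∈ B'.fixSub P, g.toFun y = z) :
    ∃ w, (ShortComplex.mk f.natTrans g.natTrans w).ShortExact := by
  have w : f.natTrans ≫ g.natTrans = 0 := by
    ext P x
    exact Subtype.ext (hfg _ x.2.1)
  refine ⟨w, ?_⟩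
  have hmono : Mono f.natTrans := by
    have : ∀ P, Mono (f.natTrans.app P) := fun P => by
      rw [AddCommGrpCat.mono_iff_injective]
      intro x y hxy
      exact Subtype.ext (hf (congrArg Subtype.val hxy))
    exact NatTrans.mono_of_mono_app _
  have hepi : Epi g.natTrans := by
    have : ∀ P, Epi (g.natTrans.app P) := fun P => by
      rw [AddCommGrpCat.epi_iff_surjective]
      intro z
      obtain ⟨y, hy, hyz⟩ := hg _ P.unop.le _ z.2
      exact ⟨⟨y, hy⟩, Subtype.ext hyz⟩
    exact NatTrans.epi_of_epi_app _
  refine ShortComplex.ShortExact.mk' ?_ hmono hepi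
  -- Evaluations jointly reflect isomorphisms, so exactness in the middle may be tested at each
  -- subgroup, as exactness of abelian groups.
  have hJ : JointlyReflectIsomorphisms
      (fun P : (OrbitCat S)ᵒᵖ => (evaluation (OrbitCat S)ᵒᵖ AddCommGrpCat.{0}).obj P) :=
    ⟨fun {X Y} f hf => by
      have : ∀ P, IsIso (f.app P) := hf
      exact NatIso.isIso_of_isIso_app f⟩
  rw [hJ.exact_iff]
  intro P
  rw [ShortComplex.ab_exact_iff]
  intro y hy
  obtain ⟨x, hx, hxy⟩ := hex _ P.unop.le _ (Subtype.prop (p := (· ∈ B'.fixSub P.unop.sub)) y)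
    (congrArg Subtype.val hy)
  exact ⟨⟨x, hx⟩, Subtype.ext hxy⟩

end PermLattice

/-! ### Representable functors -/

section FreeYoneda

variable {C : Type} [Category.{0} C]

/-- The free abelian presheaf on a representable presheaf. -/
noncomputable def freeYoneda (Q : C) : Cᵒᵖ ⥤ AddCommGrpCat.{0} := yoneda.obj Q ⋙ AddCommGrpCat.free

/-- The morphism from the free abelian presheaf on `Q` given by an element at `Q`. -/
noncomputable def freeYonedaDesc {Q : C} {F : Cᵒᵖ ⥤ AddCommGrpCat.{0}} (x : F.obj (.op Q)) :
    freeYoneda Q ⟶ F where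
  app P := AddCommGrpCat.ofHom (FreeAbelianGroup.lift fun φ : P.unop ⟶ Q => F.map φ.op x)
  naturality P P' ψ := by
    apply AddCommGrpCat.hom_ext
    apply FreeAbelianGroup.lift_ext
    intro φ
    change FreeAbelianGroup.lift _ (FreeAbelianGroup.map _ (FreeAbelianGroup.of φ)) =
      F.map ψ (FreeAbelianGroup.lift _ (FreeAbelianGroup.of φ))
    rw [FreeAbelianGroup.map_of_apply, FreeAbelianGroup.lift_apply_of,
      FreeAbelianGroup.lift_apply_of]
    exact ConcreteCategory.congr_hom (F.map_comp φ.op ψ) x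

/-- The generator of the free abelian presheaf on `Q`. -/
noncomputable def freeYonedaGen (Q : C) : (freeYoneda Q).obj (.op Q) := FreeAbelianGroup.of (𝟙 Q)

theorem freeYoneda_hom_ext {Q : C} {F : Cᵒᵖ ⥤ AddCommGrpCat.{0}} {α β : freeYoneda Q ⟶ F}
    (h : α.app _ (freeYonedaGen Q) = β.app _ (freeYonedaGen Q)) : α = β := by
  apply NatTrans.ext
  funext P
  apply AddCommGrpCat.hom_ext
  apply FreeAbelianGroup.lift_ext
  intro φ
  have h1 (γ : freeYoneda Q ⟶ F) : γ.app P (FreeAbelianGroup.of φ) =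
      F.map φ.op (γ.app _ (freeYonedaGen Q)) := by
    refine Eq.trans ?_ (NatTrans.naturality_apply γ φ.op (freeYonedaGen Q))
    congr 1
    refine Eq.trans ?_ (FreeAbelianGroup.map_of_apply _).symm
    exact congrArg FreeAbelianGroup.of (Category.comp_id φ).symm
  exact (h1 α).trans ((congrArg _ h).trans (h1 β).symm)

theorem freeYonedaDesc_gen {Q : C} {F : Cᵒᵖ ⥤ AddCommGrpCat.{0}} (x : F.obj (.op Q)) :
    (freeYonedaDesc x).app _ (freeYonedaGen Q) = x := by
  refine (FreeAbelianGroup.lift_apply_of _ _).trans ?_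
  exact ConcreteCategory.congr_hom (F.map_id _) x

/-- By Yoneda, morphisms out of `freeYoneda Q` are elements at `Q`, and an epimorphism of functors
is surjective at `Q`. -/
instance freeYoneda_projective (Q : C) : Projective (freeYoneda Q) where
  factors {E X} f e he := by
    have : Function.Surjective (e.app (.op Q)) := by
      rw [← AddCommGrpCat.epi_iff_surjective]
      infer_instance
    obtain ⟨y, hy⟩ := this (f.app _ (freeYonedaGen Q))
    refine ⟨freeYonedaDesc y, freeYoneda_hom_ext ?_⟩
    refine Eq.trans ?_ hy
    exact congrArg _ (freeYonedaDesc_gen y)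

theorem extVanish_freeYoneda (Q : C) (F : Cᵒᵖ ⥤ AddCommGrpCat.{0})
    (h : ∀ x : F.obj (.op Q), x = 0) : ExtVanish (freeYoneda Q) F :=
  ExtVanish.of_projective fun _ => freeYoneda_hom_ext ((h _).trans (h _).symm)

end FreeYoneda

/-! ### Permutation functors -/

namespace PermLattice

variable {Γ : Type} [Group Γ] {Ω Ω' : Type} [MulAction Γ Ω] [MulAction Γ Ω']

/-- The lattice of functions supported on an invariant subset. -/
def supported (X : Set Ω) (hX : ∀ (g : Γ) (x : Ω), g • x ∈ X → x ∈ X) : PermLattice Γ Ω where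
  sub :=
    { carrier := {f | ∀ x, f x ≠ 0 → x ∈ X}
      zero_mem' := fun x hx => (hx rfl).elim
      add_mem' := by
        intro f f' hf hf' x hx
        by_cases h : f x = 0
        · exact hf' x fun h' => hx (by simp [h, h'])
        · exact hf x h
      neg_mem' := by
        intro f hf x hx
        exact hf x fun h => hx (by simp [h]) }
  comp_smul_mem g f hf x hx := hX g x (hf _ hx)

/-- The lattice of all functions. -/
def all (Γ Ω : Type) [Group Γ] [MulAction Γ Ω] : PermLattice Γ Ω where
  sub := ⊤
  comp_smul_mem _ _ _ := trivial

variable {S : Subgroup Γ}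

/-! ### Transitive permutation functors are free on representables -/

section Coset

open Classical in
/-- The indicator function of the coset of `1`. -/
noncomputable def cosetOne (Q : OrbitCat S) : (all Γ (Γ ⧸ Q.sub)).fixSub Q.sub :=
  ⟨Pi.single ((1 : Γ) : Γ ⧸ Q.sub) 1, trivial, by
    intro x hx g hg
    have : x = ((1 : Γ) : Γ ⧸ Q.sub) := by
      by_contra h
      exact hx (Pi.single_eq_of_ne h _)
    rw [this, MulAction.Quotient.smul_coe, smul_eq_mul, mul_one]
    exact (QuotientGroup.eq.mpr (by simpa using hg)).symm⟩

/-- The comparison of the free presheaf on `Q` with the functor of `Γ ⧸ Q`. -/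
noncomputable def cosetHom (Q : OrbitCat S) :
    freeYoneda Q ⟶ (all Γ (Γ ⧸ Q.sub)).functor S :=
  freeYonedaDesc (F := (all Γ (Γ ⧸ Q.sub)).functor S) (cosetOne Q)

open Classical in
theorem cosetHom_of (Q P : OrbitCat S) (φ : P ⟶ Q) :
    (show (all Γ (Γ ⧸ Q.sub)).fixSub P.sub from
      (cosetHom Q).app (.op P) (FreeAbelianGroup.of φ)).1 =
      Pi.single (OrbitCat.toMap φ ((1 : Γ) : Γ ⧸ P.sub)) 1 := by
  have h : (cosetHom Q).app (.op P) (FreeAbelianGroup.of φ) =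
      ((all Γ (Γ ⧸ Q.sub)).functor S).map φ.op (cosetOne Q) :=
    FreeAbelianGroup.lift_apply_of _ _
  rw [h]
  funext x
  change (Pi.single ((1 : Γ) : Γ ⧸ Q.sub) (1 : ℤ) : Γ ⧸ Q.sub → ℤ) ((OrbitCat.rep φ)⁻¹ • x) = _
  have h1 : OrbitCat.toMap φ ((1 : Γ) : Γ ⧸ P.sub) = OrbitCat.rep φ • ((1 : Γ) : Γ ⧸ Q.sub) := by
    rw [OrbitCat.toMap_mk, one_mul, MulAction.Quotient.smul_coe, smul_eq_mul, mul_one]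
  rw [h1, Pi.single_apply, Pi.single_apply]
  simp only [inv_smul_eq_iff]

/-- An equivariant map Γ/P → Γ/Q is the same as a P-fixed point of Γ/Q, namely the image of the
coset of 1; so the functions supported on these points are free on the morphisms P ⟶ Q. -/
theorem isIso_cosetHom [Finite Γ] (Q : OrbitCat S) : IsIso (cosetHom Q) := by
  classical
  have : ∀ P, IsIso ((cosetHom Q).app P) := by
    rintro ⟨P⟩
    have hinj : Function.Injective
        (fun φ : P ⟶ Q => OrbitCat.toMap φ ((1 : Γ) : Γ ⧸ P.sub)) :=
      fun φ ψ h => OrbitCat.hom_ext_one h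
    have : Finite (P ⟶ Q) := Finite.of_injective _ hinj
    have := Fintype.ofFinite (P ⟶ Q)
    let e : (all Γ (Γ ⧸ Q.sub)).fixSub P.sub →+ FreeAbelianGroup (P ⟶ Q) :=
      { toFun f := ∑ φ : P ⟶ Q,
          f.1 (OrbitCat.toMap φ ((1 : Γ) : Γ ⧸ P.sub)) • FreeAbelianGroup.of φ
        map_zero' := by simp
        map_add' f f' := by simp [add_smul, Finset.sum_add_distrib] }
    let c : FreeAbelianGroup (P ⟶ Q) →+ (all Γ (Γ ⧸ Q.sub)).fixSub P.sub :=
      ((cosetHom Q).app (.op P)).hom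
    have hc (φ : P ⟶ Q) : (c (FreeAbelianGroup.of φ)).1 =
      Pi.single (OrbitCat.toMap φ ((1 : Γ) : Γ ⧸ P.sub)) 1 := cosetHom_of Q P φ
    have hec : e.comp c = AddMonoidHom.id _ := by
      apply FreeAbelianGroup.lift_ext
      intro φ
      change ∑ ψ : P ⟶ Q, (c (FreeAbelianGroup.of φ)).1
          (OrbitCat.toMap ψ ((1 : Γ) : Γ ⧸ P.sub)) • FreeAbelianGroup.of ψ = _
      rw [hc, Finset.sum_eq_single φ]
      · simp
      · intro ψ _ hψ
        rw [Pi.single_eq_of_ne (fun h => hψ (hinj h)), zero_smul]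
      · simp
    have hce : c.comp e = AddMonoidHom.id _ := by
      ext f x
      change (c (∑ ψ : P ⟶ Q, f.1
          (OrbitCat.toMap ψ ((1 : Γ) : Γ ⧸ P.sub)) • FreeAbelianGroup.of ψ)).1 x = f.1 x
      have h1 : (c (∑ ψ : P ⟶ Q, f.1
          (OrbitCat.toMap ψ ((1 : Γ) : Γ ⧸ P.sub)) • FreeAbelianGroup.of ψ)).1 x =
          ∑ ψ : P ⟶ Q, f.1 (OrbitCat.toMap ψ ((1 : Γ) : Γ ⧸ P.sub)) *
            (Pi.single (OrbitCat.toMap ψ ((1 : Γ) : Γ ⧸ P.sub)) (1 : ℤ) : Γ ⧸ Q.sub → ℤ) x := by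
        simp [map_sum, hc, Finset.sum_apply]
      rw [h1]
      by_cases hx : f.1 x = 0
      · rw [hx]
        refine Finset.sum_eq_zero fun ψ _ => ?_
        rw [Pi.single_apply]
        split_ifs with h
        · rw [← h, hx, zero_mul]
        · rw [mul_zero]
      · obtain ⟨a, rfl⟩ := QuotientGroup.mk_surjective x
        have ha : ∀ g ∈ P.sub, a⁻¹ * g * a ∈ Q.sub := by
          intro g hg
          have := f.2.2 _ hx g hg
          rw [MulAction.Quotient.smul_coe, smul_eq_mul] at this
          simpa [mul_assoc] using QuotientGroup.eq.mp this.symm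
        have hφ := OrbitCat.toMap_homOfConj (P := P) (Q := Q) a ha
        rw [Finset.sum_eq_single (OrbitCat.homOfConj a ha)]
        · rw [hφ]
          simp
        · intro ψ _ hψ
          rw [Pi.single_eq_of_ne, mul_zero]
          intro h
          exact hψ (hinj (h.symm.trans hφ.symm))
        · simp
    have hbij : Function.Bijective c :=
      ⟨Function.LeftInverse.injective (g := e) (DFunLike.congr_fun hec),
        Function.RightInverse.surjective (g := e) (DFunLike.congr_fun hce)⟩
    exact (ConcreteCategory.isIso_iff_bijective _).mpr hbij
  exact NatIso.isIso_of_isIso_app _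

theorem extVanish_coset [Finite Γ] (Q : OrbitCat S) (F : (OrbitCat S)ᵒᵖ ⥤ AddCommGrpCat.{0})
    (h : ∀ x : F.obj (.op Q), x = 0) : ExtVanish ((all Γ (Γ ⧸ Q.sub)).functor S) F :=
  have := isIso_cosetHom Q
  (extVanish_freeYoneda Q F h).of_iso (asIso (cosetHom Q)).symm

end Coset

/-! ### Transfer along equivariant maps -/

section Transfer

variable {X : Set Ω} {hX : ∀ (g : Γ) (x : Ω), g • x ∈ X → x ∈ X}

/-- Restriction of functions along an equivariant map that reflects fixed points. -/
def pullback (κ : Ω' →[Γ] Ω) (hκ : ∀ P ≤ S, ∀ z, (∀ g ∈ P, g • κ z = κ z) → ∀ g ∈ P, g • z = z)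
    (c : ℤ) : Hom S (supported X hX) (all Γ Ω') where
  toFun :=
    { toFun f := fun z => c * f (κ z)
      map_zero' := by ext; simp
      map_add' f f' := by ext; simp [mul_add] }
  map_comp_smul g f := by
    funext z
    simp
  mem P hP f hf := ⟨trivial, fun z hz => hκ P hP z (hf.2 _ (right_ne_zero_of_mul hz))⟩

open Classical in
/-- Summation of functions over the fibres of an equivariant map. -/
noncomputable def pushforward [Fintype Ω'] (κ : Ω' →[Γ] Ω) (hκ : ∀ z, κ z ∈ X) :
    Hom S (all Γ Ω') (supported X hX) where
  toFun :=
    { toFun f := fun y => ∑ z with κ z = y, f z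
      map_zero' := by ext; simp
      map_add' f f' := by ext; simp [Finset.sum_add_distrib] }
  map_comp_smul g f := by
    funext y
    refine Finset.sum_bij (fun z _ => g • z) ?_ ?_ ?_ ?_
    · intro z hz
      simpa using hz
    · intro z _ z' _ h
      simpa using h
    · intro z hz
      refine ⟨g⁻¹ • z, ?_, by simp⟩
      simp only [Finset.mem_filter, Finset.mem_univ, true_and] at hz ⊢
      rw [map_smul, hz, inv_smul_smul]
    · intro z _
      rfl
  mem P _ f hf := by
    refine ⟨fun y hy => ?_, fun y hy g hg => ?_⟩ <;>
    · obtain ⟨z, hz, hfz⟩ := Finset.exists_ne_zero_of_sum_ne_zero hy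
      simp only [Finset.mem_filter, Finset.mem_univ, true_and] at hz
      first
      | exact hz ▸ hκ z
      | rw [← hz, ← map_smul, hf.2 z hfz g hg]

open Classical in
theorem pushforward_pullback_apply [Fintype Ω'] (κ : Ω' →[Γ] Ω) (hκ : ∀ z, κ z ∈ X)
    (hκ' : ∀ P ≤ S, ∀ z, (∀ g ∈ P, g • κ z = κ z) → ∀ g ∈ P, g • z = z) (c : ℤ) (f : Ω → ℤ)
    (y : Ω) :
    (pushforward (S := S) (hX := hX) κ hκ).toFun
      ((pullback (hX := hX) κ hκ' c).toFun f) y =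
      (c * (Finset.univ.filter fun z => κ z = y).card) * f y := by
  change ∑ z with κ z = y, c * f (κ z) = _
  rw [Finset.sum_congr rfl (g := fun _ => c * f y), Finset.sum_const, nsmul_eq_mul]
  · ring
  · intro z hz
    simp only [Finset.mem_filter, Finset.mem_univ, true_and] at hz
    rw [hz]

end Transfer

end PermLattice

/-! ### Points with a largest fixing p-subgroup, and vanishing of Ext for permutation functors -/

namespace PermLattice

section Permutation

variable {Γ : Type} [Group Γ] {Ω : Type} [MulAction Γ Ω] {p : ℕ}

/-- The value of a morphism at a function and a point. -/
noncomputable def evalHom {S : Subgroup Γ} {F : (OrbitCat S)ᵒᵖ ⥤ AddCommGrpCat.{0}}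
    {B : PermLattice Γ Ω} (P : (OrbitCat S)ᵒᵖ) (f : F.obj P) (x : Ω) :
    (F ⟶ B.functor S) →+ ℤ where
  toFun α := (show B.fixSub P.unop.sub from α.app P f).1 x
  map_zero' := rfl
  map_add' _ _ := rfl

theorem functor_hom_ext_evalHom {S : Subgroup Γ} {F : (OrbitCat S)ᵒᵖ ⥤ AddCommGrpCat.{0}}
    {B : PermLattice Γ Ω} {α β : F ⟶ B.functor S}
    (h : ∀ P f x, evalHom P f x α = evalHom P f x β) : α = β :=
  functor_hom_ext fun P f => funext (h P f)

/-- `Q` is a `p`-subgroup that contains exactly those `p`-subgroups that fix `x`. -/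
def IsFixer (p : ℕ) (Q : Subgroup Γ) (x : Ω) : Prop :=
  IsPGroup p Q ∧ ∀ P : Subgroup Γ, IsPGroup p P → ((∀ g ∈ P, g • x = x) ↔ P ≤ Q)

theorem conj_fixes_iff (P : Subgroup Γ) (g : Γ) (x : Ω) :
    (∀ h ∈ MulAut.conj g • P, h • g • x = g • x) ↔ ∀ h ∈ P, h • x = x := by
  constructor
  · intro H h hh
    have := H _ (Subgroup.smul_mem_pointwise_smul h (MulAut.conj g) P hh)
    simpa [mul_smul] using this
  · rintro H _ ⟨h, hh, rfl⟩
    have := H h hh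
    change (g * h * g⁻¹) • g • x = g • x
    simp [mul_smul, this]

theorem IsFixer.conj {Q : Subgroup Γ} {x : Ω} (h : IsFixer p Q x) (g : Γ) :
    IsFixer p (MulAut.conj g • Q) (g • x) := by
  refine ⟨h.1.map _, fun P hP => ?_⟩
  have hP' : P = MulAut.conj g • (MulAut.conj g)⁻¹ • P := (smul_inv_smul _ _).symm
  have h1 := conj_fixes_iff ((MulAut.conj g)⁻¹ • P) g x
  rw [← hP'] at h1
  rw [h1]
  refine (h.2 ((MulAut.conj g)⁻¹ • P) (hP.map _)).trans ?_
  rw [← Subgroup.pointwise_smul_le_pointwise_smul_iff (a := MulAut.conj g), ← hP']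

theorem IsFixer.smul_eq {Q : Subgroup Γ} {x : Ω} (h : IsFixer p Q x) {g : Γ} (hg : g ∈ Q) :
    g • x = x :=
  (h.2 Q h.1).2 le_rfl g hg

/-- The map `gQ ↦ gx`. -/
def IsFixer.orbitMap {Q : Subgroup Γ} {x : Ω} (h : IsFixer p Q x) : (Γ ⧸ Q) →[Γ] Ω where
  toFun := Quotient.lift (fun g => g • x) (by
    intro a b hab
    have := h.smul_eq (QuotientGroup.leftRel_apply.mp hab)
    rw [mul_smul, inv_smul_eq_iff] at this
    exact this.symm)
  map_smul' := by
    rintro g ⟨a⟩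
    exact mul_smul g a x

theorem IsFixer.orbitMap_mk {Q : Subgroup Γ} {x : Ω} (h : IsFixer p Q x) (g : Γ) :
    h.orbitMap (g : Γ ⧸ Q) = g • x := rfl

/-- A p-subgroup that fixes ax lies in the conjugate aQa⁻¹, which is the stabilizer of the coset aQ.
This is the condition under which `pullback` respects supports. -/
theorem IsFixer.orbitMap_reflects {Q : Subgroup Γ} {x : Ω} (h : IsFixer p Q x) {P : Subgroup Γ}
    (hP : IsPGroup p P) (z : Γ ⧸ Q) (hz : ∀ g ∈ P, g • h.orbitMap z = h.orbitMap z) :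
    ∀ g ∈ P, g • z = z := by
  obtain ⟨a, rfl⟩ := QuotientGroup.mk_surjective z
  intro g hg
  rw [h.orbitMap_mk] at hz
  have h1 := ((h.conj a).2 P hP).1 hz hg
  rw [Subgroup.mem_pointwise_smul_iff_inv_smul_mem] at h1
  rw [MulAction.Quotient.smul_coe, smul_eq_mul]
  refine (QuotientGroup.eq.mpr ?_).symm
  simpa [mul_assoc] using h1

/-- The fibre is Stab(x)/Q, and Q is a Sylow subgroup of Stab(x), because it contains all
p-subgroups of Stab(x). -/
theorem IsFixer.not_dvd_card_fibre [Finite Γ] [Fact p.Prime] {Q : Subgroup Γ} {x : Ω}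
    (h : IsFixer p Q x) : ¬ p ∣ Nat.card {z // h.orbitMap z = x} := by
  let H := MulAction.stabilizer Γ x
  have hQH : Q ≤ H := fun g hg => h.smul_eq hg
  have hQ : IsPGroup p (Q.subgroupOf H) := h.1.comap_subtype
  let Q' : Sylow p H := ⟨Q.subgroupOf H, hQ, fun {P} hP hle => by
    have h1 : P.map H.subtype ≤ Q := (h.2 _ (hP.map _)).1 (by
      rintro _ ⟨g, _, rfl⟩
      exact g.2)
    exact le_antisymm (Subgroup.map_le_iff_le_comap.mp h1) hle⟩
  have h2 := Q'.not_dvd_index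
  let j : H ⧸ Q.subgroupOf H → Γ ⧸ Q := Quotient.map' H.subtype (by
    intro a b hab
    rw [QuotientGroup.leftRel_apply] at hab ⊢
    exact hab)
  have e : (H ⧸ Q.subgroupOf H) ≃ {z // h.orbitMap z = x} :=
    Equiv.ofBijective
      (fun z => ⟨j z, by
        obtain ⟨a, rfl⟩ := QuotientGroup.mk_surjective z
        exact a.2⟩) ⟨by
        intro z z' hz
        obtain ⟨a, rfl⟩ := QuotientGroup.mk_surjective z
        obtain ⟨b, rfl⟩ := QuotientGroup.mk_surjective z'
        have h3 : ((a : Γ) : Γ ⧸ Q) = ((b : Γ) : Γ ⧸ Q) := congrArg Subtype.val hz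
        have h4 := QuotientGroup.eq.mp h3
        exact QuotientGroup.eq.mpr h4,
        by
        rintro ⟨z, hz⟩
        obtain ⟨a, rfl⟩ := QuotientGroup.mk_surjective z
        exact ⟨((⟨a, hz⟩ : H) : H ⧸ Q.subgroupOf H), rfl⟩⟩
  rw [← Nat.card_congr e]
  exact h2

theorem card_fibre_smul {Ω' : Type} [MulAction Γ Ω'] (κ : Ω' →[Γ] Ω) (g : Γ) (x : Ω) :
    Nat.card {z // κ z = g • x} = Nat.card {z // κ z = x} := by
  refine Nat.card_congr
    { toFun z := ⟨g⁻¹ • z.1, by rw [map_smul, z.2, inv_smul_smul]⟩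
      invFun z := ⟨g • z.1, by rw [map_smul, z.2]⟩
      left_inv z := by simp
      right_inv z := by simp }

/-- Objects of the orbit category must lie in the fixed Sylow subgroup `T`; conjugating the fixer
into `T` amounts to moving x within its orbit. -/
theorem exists_isFixer_le {T : Sylow p Γ} [Finite Γ] [Fact p.Prime] {Q : Subgroup Γ} {x : Ω}
    (h : IsFixer p Q x) (hQ : Q ≠ ⊥) :
    ∃ (g : Γ) (R : OrbitCat (T : Subgroup Γ)), IsFixer p R.sub (g • x) ∧ R.sub ≠ ⊥ := by
  obtain ⟨T', hT'⟩ := h.1.exists_le_sylow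
  obtain ⟨g, rfl⟩ := MulAction.exists_smul_eq Γ T' T
  refine ⟨g, ⟨MulAut.conj g • Q, ?_⟩, h.conj g, ?_⟩
  · exact Subgroup.pointwise_smul_le_pointwise_smul_iff.mpr hT'
  · intro h0
    apply hQ
    have := congrArg (fun K => (MulAut.conj g)⁻¹ • K) h0
    simpa using this

/-- A permutation functor has no `Ext` into a functor that is killed by `p` and vanishes away
from the trivial subgroup, if every point of the permutation set is fixed by a largest
`p`-subgroup, and this subgroup is nontrivial. -/
theorem extVanish_supported [Finite Γ] [Fact p.Prime] [Finite Ω] (T : Sylow p Γ)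
    {F : (OrbitCat (T : Subgroup Γ))ᵒᵖ ⥤ AddCommGrpCat.{0}} (hF : (p : ℤ) • 𝟙 F = 0)
    (hF0 : ∀ Q : OrbitCat (T : Subgroup Γ), Q.sub ≠ ⊥ → ∀ x : F.obj (.op Q), x = 0)
    {X : Set Ω} {hX : ∀ (g : Γ) (x : Ω), g • x ∈ X → x ∈ X}
    (hR : ∀ x ∈ X, ∃ R : Subgroup Γ, IsFixer p R x ∧ R ≠ ⊥) :
    ExtVanish ((supported X hX).functor (T : Subgroup Γ)) F := by
  classical
  have := Fintype.ofFinite Γ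
  have := Fintype.ofFinite Ω
  have hX' (g : Γ) (x : Ω) (hx : x ∈ X) : g • x ∈ X := hX g⁻¹ _ (by simpa using hx)
  let J := {q : MulAction.orbitRel.Quotient Γ Ω // ∃ x ∈ X, Quotient.mk _ x = q}
  have hJ (q : J) : ∃ (x : Ω) (R : OrbitCat (T : Subgroup Γ)), x ∈ X ∧ Quotient.mk _ x = q.1 ∧
      IsFixer p R.sub x ∧ R.sub ≠ ⊥ := by
    obtain ⟨q, x, hx, rfl⟩ := q
    obtain ⟨Q, hQ, hQ'⟩ := hR x hx
    obtain ⟨g, R, h⟩ := exists_isFixer_le (T := T) hQ hQ'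
    exact ⟨g • x, R, hX' g x hx, Quotient.sound ⟨g, rfl⟩, h⟩
  choose y R hyX hyq hfix hne using hJ
  let κ (q : J) := (hfix q).orbitMap
  have hκX (q : J) (z) : κ q z ∈ X := by
    obtain ⟨a, rfl⟩ := QuotientGroup.mk_surjective z
    exact hX' a _ (hyX q)
  have hκ (q : J) : ∀ P ≤ (T : Subgroup Γ), ∀ z, (∀ g ∈ P, g • κ q z = κ q z) →
      ∀ g ∈ P, g • z = z :=
    fun P hP z hz => (hfix q).orbitMap_reflects (T.2.to_le hP) z hz
  let N (q : J) : ℕ := Nat.card {z // κ q z = y q}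
  let m : ℤ := ∏ q, (N q : ℤ)
  -- The fibre sizes differ from orbit to orbit. Weighting each orbit by the product of the other
  -- sizes makes every composite the same multiple m of the identity.
  let c (q : J) : ℤ := ∏ q' ∈ Finset.univ.erase q, (N q' : ℤ)
  have hm : IsCoprime m (p : ℤ) := by
    refine IsCoprime.prod_left fun q _ => ?_
    rw [Nat.isCoprime_iff_coprime]
    exact ((Nat.Prime.coprime_iff_not_dvd Fact.out).mpr (hfix q).not_dvd_card_fibre).symm
  refine ExtVanish.of_sum_comp hF hm Finset.univ
    (fun q => (all Γ (Γ ⧸ (R q).sub)).functor (T : Subgroup Γ))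
    (fun q => (pullback (κ q) (hκ q) (c q)).natTrans)
    (fun q => (pushforward (κ q) (hκX q)).natTrans) ?_
    (fun q _ => extVanish_coset (R q) F (hF0 _ (hne q)))
  apply functor_hom_ext_evalHom
  intro P f x
  have key : ∑ q, (pushforward (S := (T : Subgroup Γ)) (hX := hX) (κ q) (hκX q)).toFun
      ((pullback (hX := hX) (κ q) (hκ q) (c q)).toFun f.1) x = m * f.1 x := by
    simp only [pushforward_pullback_apply]
    by_cases hfx : f.1 x = 0
    · simp [hfx]
    · have hx : x ∈ X := f.2.1 x hfx
      -- Only the orbit of x meets the fibre over x, so a single summand survives.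
      let q₀ : J := ⟨Quotient.mk _ x, x, hx, rfl⟩
      rw [Finset.sum_eq_single q₀]
      · obtain ⟨g, hg⟩ := Quotient.exact (hyq q₀)
        have h1 : x = g⁻¹ • y q₀ := by
          rw [← hg]; simp
        congr 1
        have h2 : ((Finset.univ.filter fun z => κ q₀ z = x).card : ℤ) = N q₀ := by
          rw [← Fintype.card_subtype, ← Nat.card_eq_fintype_card]
          congr 1
          exact (congrArg (fun w => Nat.card {z // κ q₀ z = w}) h1).trans
            (card_fibre_smul (κ q₀) g⁻¹ (y q₀))
        rw [h2, mul_comm]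
        exact Finset.mul_prod_erase _ (fun q => (N q : ℤ)) (Finset.mem_univ q₀)
      · intro q _ hq
        have : (Finset.univ.filter fun z => κ q z = x) = ∅ := by
          rw [Finset.filter_eq_empty_iff]
          intro z _ hz
          apply hq
          obtain ⟨a, rfl⟩ := QuotientGroup.mk_surjective z
          apply Subtype.ext
          rw [← hyq q]
          exact Quotient.sound ⟨a⁻¹, by simp [← hz, κ, (hfix q).orbitMap_mk]⟩
        rw [this]
        simp
      · simp
  rw [map_sum, map_zsmul, smul_eq_mul]
  exact key

end Permutation

end PermLattice

/-! ### Lattices of functions of several variables -/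

section Slots

variable {ι Γ G : Type} [Group Γ] [Group G]

/-- Families of points of `L`, with the action of `Γ` through `π : Γ → G^ι`. -/
def Slots (_ : Γ →* (ι → G)) (L : Type) : Type := ι → L

variable {π : Γ →* (ι → G)} {L : Type}

instance [MulAction G L] : MulAction Γ (Slots π L) := MulAction.compHom (ι → L) π

instance [Finite ι] [Finite L] : Finite (Slots π L) := inferInstanceAs (Finite (ι → L))

/-- The `i`-th coordinate of `π`. -/
def slotProj (π : Γ →* (ι → G)) (i : ι) : Γ →* G := (Pi.evalMonoidHom _ i).comp π

theorem Slots.smul_apply [MulAction G L] (g : Γ) (x : Slots π L) (i : ι) :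
    (g • x) i = slotProj π i g • x i := rfl

variable [DecidableEq ι]

/-- Change the `i`-th coordinate. -/
def Slots.update (x : Slots π L) (i : ι) (l : L) : Slots π L := Function.update x i l

theorem Slots.update_self (x : Slots π L) (i : ι) (l : L) : x.update i l i = l :=
  Function.update_self _ _ _

theorem Slots.update_of_ne (x : Slots π L) {i j : ι} (h : j ≠ i) (l : L) : x.update i l j = x j :=
  Function.update_of_ne h _ _

theorem Slots.update_idem (x : Slots π L) (i : ι) (l l' : L) :
    (x.update i l).update i l' = x.update i l' :=
  Function.update_idem _ _ _

theorem Slots.update_comm (x : Slots π L) {i j : ι} (h : i ≠ j) (l l' : L) :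
    (x.update i l).update j l' = (x.update j l').update i l :=
  Function.update_comm h _ _ _

theorem Slots.update_eq_self (x : Slots π L) (i : ι) : x.update i (x i) = x :=
  Function.update_eq_self _ _

theorem Slots.smul_update [MulAction G L] (g : Γ) (x : Slots π L) (i : ι) (l : L) :
    g • x.update i l = (g • x).update i (slotProj π i g • l) := by
  funext j
  rw [Slots.smul_apply]
  rcases eq_or_ne j i with rfl | h
  · rw [Slots.update_self, Slots.update_self]
  · rw [Slots.update_of_ne _ h, Slots.update_of_ne _ h, Slots.smul_apply]

/-- The restriction of a function to a line in direction `i`. -/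
def slice (f : Slots π L → ℤ) (i : ι) (x : Slots π L) : L → ℤ := fun l => f (x.update i l)

/-- Apply an operator on functions in the `i`-th variable. -/
def slot (i : ι) (h : (L → ℤ) →+ (L → ℤ)) : (Slots π L → ℤ) →+ (Slots π L → ℤ) where
  toFun f x := h (slice f i x) (x i)
  map_zero' := by
    funext x
    exact congrFun (map_zero h) (x i)
  map_add' f f' := by
    funext x
    exact congrFun (map_add h (slice f i x) (slice f' i x)) (x i)

theorem slot_apply (i : ι) (h : (L → ℤ) →+ (L → ℤ)) (f : Slots π L → ℤ) (x : Slots π L) :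
    slot i h f x = h (slice f i x) (x i) := rfl

theorem slice_update_self (f : Slots π L → ℤ) (i : ι) (x : Slots π L) (l : L) :
    slice f i (x.update i l) = slice f i x := by
  funext l'
  rw [slice, slice, Slots.update_idem]

theorem slice_slot_self (i : ι) (h : (L → ℤ) →+ (L → ℤ)) (f : Slots π L → ℤ) (x : Slots π L) :
    slice (slot i h f) i x = h (slice f i x) := by
  funext l
  rw [slice, slot_apply, slice_update_self, Slots.update_self]

theorem apply_eq_sum [Fintype L] [DecidableEq L] (h : (L → ℤ) →+ (L → ℤ)) (u : L → ℤ) (t : L) :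
    h u t = ∑ l, u l * h (Pi.single l 1) t := by
  have h1 : u = ∑ l, u l • (Pi.single l 1 : L → ℤ) := by
    rw [← pi_eq_sum_univ' u]
  conv_lhs => rw [h1, map_sum, Finset.sum_apply]
  simp only [map_zsmul, Pi.smul_apply, smul_eq_mul]

/-- An operator in the i-th variable turns slices in another direction into integral combinations of
slices of the original function, so membership in the lattices of the other variables is preserved.
Finiteness of `L` lets the operator be written as a matrix. -/
theorem slice_slot_of_ne [Fintype L] [DecidableEq L] {i j : ι} (hij : j ≠ i)
    (h : (L → ℤ) →+ (L → ℤ)) (f : Slots π L → ℤ) (x : Slots π L) :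
    slice (slot i h f) j x =
      ∑ l, h (Pi.single l 1) (x i) • slice f j (x.update i l) := by
  funext l'
  rw [slice, slot_apply, apply_eq_sum, Slots.update_of_ne _ hij.symm, Finset.sum_apply]
  refine Finset.sum_congr rfl fun l _ => ?_
  rw [Pi.smul_apply, slice, slice, Slots.update_comm _ hij, smul_eq_mul, mul_comm]

variable [MulAction G L]

namespace PermLattice

/-- Functions of several variables all of whose restrictions to lines in direction `i` lie in the
`i`-th lattice. -/
def tens (π : Γ →* (ι → G)) (B : ι → PermLattice G L) : PermLattice Γ (Slots π L) where
  sub :=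
    { carrier := {f | ∀ i x, slice f i x ∈ (B i).sub}
      zero_mem' := fun i _ => (B i).sub.zero_mem
      add_mem' := fun hf hf' i x => (B i).sub.add_mem (hf i x) (hf' i x)
      neg_mem' := fun hf i x => (B i).sub.neg_mem (hf i x) }
  comp_smul_mem g f hf i x := by
    have h := (B i).comp_smul_mem (slotProj π i g) _ (hf i (g • x))
    convert h using 1
    funext l
    rw [slice, slice, Slots.smul_update]

variable {B C : ι → PermLattice G L}

theorem mem_tens {f : Slots π L → ℤ} :
    f ∈ (tens π B).sub ↔ ∀ i x, slice f i x ∈ (B i).sub := Iff.rfl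

theorem slice_mem_fixSub {P : Subgroup Γ} {f : Slots π L → ℤ} (hf : f ∈ (tens π B).fixSub P)
    (i : ι) (x : Slots π L) : slice f i x ∈ (B i).fixSub (P.map (slotProj π i)) := by
  refine ⟨hf.1 i x, ?_⟩
  rintro l hl _ ⟨g, hg, rfl⟩
  have h := congrFun (hf.2 _ hl g hg) i
  rwa [Slots.smul_apply, Slots.update_self] at h

theorem slot_mem_fixSub [Finite L] {P : Subgroup Γ} {i : ι} (hBC : ∀ j, j ≠ i → C j = B j)
    {h : (L → ℤ) →+ (L → ℤ)}
    (hh : ∀ u ∈ (B i).fixSub (P.map (slotProj π i)), h u ∈ (C i).fixSub (P.map (slotProj π i)))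
    {f : Slots π L → ℤ} (hf : f ∈ (tens π B).fixSub P) :
    slot i h f ∈ (tens π C).fixSub P := by
  classical
  have := Fintype.ofFinite L
  refine ⟨fun j x => ?_, fun x hx g hg => ?_⟩
  · rcases eq_or_ne j i with rfl | hj
    · rw [slice_slot_self]
      exact (hh _ (slice_mem_fixSub hf j x)).1
    · rw [slice_slot_of_ne hj, hBC j hj]
      exact sum_mem fun l _ => zsmul_mem (hf.1 j _) _
  · funext j
    rw [Slots.smul_apply]
    rw [slot_apply] at hx
    rcases eq_or_ne j i with rfl | hj
    · exact (hh _ (slice_mem_fixSub hf j x)).2 _ hx _ ⟨g, hg, rfl⟩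
    · have h1 : ∃ l, slice f i x l ≠ 0 := by
        by_contra! h0
        apply hx
        rw [show slice f i x = 0 from funext h0, map_zero]
        rfl
      obtain ⟨l, hl⟩ := h1
      have h2 := congrFun (hf.2 _ hl g hg) j
      rwa [Slots.smul_apply, Slots.update_of_ne _ hj] at h2

/-- The morphism given by an equivariant operator in the `i`-th variable. -/
def slotHom [Finite L] {S : Subgroup Γ} (i : ι) (hBC : ∀ j, j ≠ i → C j = B j)
    {B₀ C₀ : PermLattice G L} (hB : B i = B₀) (hC : C i = C₀)
    (h : Hom (S.map (slotProj π i)) B₀ C₀) : Hom S (tens π B) (tens π C) where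
  toFun := slot i h.toFun
  map_comp_smul g f := by
    funext x
    have h1 : slice (fun y => f (g • y)) i x =
        fun l => slice f i (g • x) (slotProj π i g • l) := by
      funext l
      rw [slice, slice, Slots.smul_update]
    rw [slot_apply, slot_apply, h1, h.map_comp_smul, Slots.smul_apply]
  mem P hP f hf := slot_mem_fixSub hBC
    (by rw [hB, hC]; exact h.mem _ (Subgroup.map_mono hP)) hf

end PermLattice

end Slots

/-! ### The building blocks -/

section Kinds

/-- Labels for the building blocks: the constants, the functions on `Y`, the functions on `Y` with
sum zero, and the functions on `Y × Y`. -/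
inductive Kind
  | const | single | sumZero | pair
deriving DecidableEq

variable {G Y : Type} [Group G] [MulAction G Y]

/-- The points that carry the functions of a given kind. -/
def Kind.support (Y : Type) : Kind → Set (Option Y × Option Y)
  | .const => {(none, none)}
  | .single => {t | t.1.isSome ∧ t.2 = none}
  | .sumZero => {t | t.1.isSome ∧ t.2 = none}
  | .pair => {t | t.1.isSome ∧ t.2.isSome}

theorem Kind.mem_support_of_smul (k : Kind) (g : G) (t : Option Y × Option Y)
    (h : g • t ∈ k.support Y) : t ∈ k.support Y := by
  rcases t with ⟨_ | y, _ | y'⟩ <;> cases k <;> simp_all [Kind.support]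

variable [Fintype Y]

/-- The lattice of functions of a given kind. -/
def Kind.lattice (G Y : Type) [Group G] [MulAction G Y] [Fintype Y] (k : Kind) :
    PermLattice G (Option Y × Option Y) where
  sub := (PermLattice.supported (k.support Y) k.mem_support_of_smul).sub ⊓
    if k = .sumZero then
      { carrier := {f | ∑ y, f (some y, none) = 0}
        zero_mem' := by simp
        add_mem' := by
          intro f f' hf hf'
          simp_all [Finset.sum_add_distrib]
        neg_mem' := by
          intro f hf
          simp_all }
    else ⊤
  comp_smul_mem g f hf := by
    refine ⟨(PermLattice.supported (k.support Y) k.mem_support_of_smul).comp_smul_mem g f hf.1, ?_⟩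
    have h := hf.2
    split_ifs with hk
    · rw [if_pos hk] at h
      refine Eq.trans ?_ h
      exact Fintype.sum_equiv (MulAction.toPerm g) _ _ fun y => rfl
    · trivial

theorem Kind.mem_lattice {k : Kind} {f : Option Y × Option Y → ℤ} :
    f ∈ (k.lattice G Y).sub ↔ (∀ t, f t ≠ 0 → t ∈ k.support Y) ∧
      (k = .sumZero → ∑ y, f (some y, none) = 0) := by
  refine and_congr Iff.rfl ?_
  split_ifs with hk <;> simp [hk]

open Classical in
/-- The sum of a function on `Y`. -/
noncomputable def augOp (Y : Type) [Fintype Y] :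
    (Option Y × Option Y → ℤ) →+ (Option Y × Option Y → ℤ) where
  toFun f t := if t = (none, none) then ∑ y, f (some y, none) else 0
  map_zero' := by ext; simp
  map_add' f f' := by ext; simp only [Pi.add_apply]; split_ifs <;> simp [Finset.sum_add_distrib]

theorem augOp_none (f : Option Y × Option Y → ℤ) :
    augOp Y f (none, none) = ∑ y, f (some y, none) := by
  simp [augOp]

theorem augOp_eq_zero {f : Option Y × Option Y → ℤ} (h : ∑ y, f (some y, none) = 0) :
    augOp Y f = 0 := by
  funext t
  simp [augOp, h]

open Classical in
/-- A constant, placed at a point of `Y`. -/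
noncomputable def pointOp {Y : Type} (y : Y) :
    (Option Y × Option Y → ℤ) →+ (Option Y × Option Y → ℤ) where
  toFun f t := if t = (some y, none) then f (none, none) else 0
  map_zero' := by ext; simp
  map_add' f f' := by ext; simp only [Pi.add_apply]; split_ifs <;> simp

/-- A function on `Y`, as a function of the first variable on `Y × Y`. -/
def pairOp (Y : Type) : (Option Y × Option Y → ℤ) →+ (Option Y × Option Y → ℤ) where
  toFun f
    | (some y, some _) => f (some y, none)
    | (some _, none) => 0
    | (none, _) => 0
  map_zero' := by ext ⟨_ | _, _ | _⟩ <;> rfl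
  map_add' f f' := by ext ⟨_ | _, _ | _⟩ <;> rfl

/-- The difference of the two marginals of a function on `Y × Y`. -/
def diffOp (Y : Type) [Fintype Y] :
    (Option Y × Option Y → ℤ) →+ (Option Y × Option Y → ℤ) where
  toFun f
    | (some y, none) => ∑ y', f (some y, some y') - ∑ y', f (some y', some y)
    | (some _, some _) => 0
    | (none, _) => 0
  map_zero' := by ext ⟨_ | _, _ | _⟩ <;> simp
  map_add' f f' := by
    ext ⟨_ | _, _ | _⟩ <;> simp [Finset.sum_add_distrib]
    ring

variable {S : Subgroup G}

/-- Summation, as an equivariant map. -/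
noncomputable def augHom : PermLattice.Hom S (Kind.single.lattice G Y) (Kind.const.lattice G Y) where
  toFun := augOp Y
  map_comp_smul g f := by
    funext t
    have h : g • t = (none, none) ↔ t = (none, none) := by
      rcases t with ⟨_ | y, _ | y'⟩ <;> simp
    by_cases ht : t = (none, none)
    · refine (if_pos ht).trans (Eq.trans ?_ (if_pos (h.mpr ht)).symm)
      exact Fintype.sum_equiv (MulAction.toPerm g : Equiv.Perm Y) _ _ fun y => rfl
    · exact (if_neg ht).trans (if_neg (mt h.mp ht)).symm
  mem P _ f hf := by
    have h (t) (ht : augOp Y f t ≠ 0) : t = (none, none) := by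
      by_contra h
      exact ht (if_neg h)
    refine ⟨Kind.mem_lattice.mpr ⟨fun t ht => h t ht, by simp⟩, fun t ht g _ => ?_⟩
    rw [h t ht]
    rfl

/-- Together with `augOp_pointOp` this splits the summation map over one subgroup P. The splitting
depends on the point y fixed by P and is not natural, but it proves surjectivity at P. -/
theorem pointOp_mem {P : Subgroup G} {y : Y} (hy : ∀ g ∈ P, g • y = y)
    {f : Option Y × Option Y → ℤ} (_ : f ∈ (Kind.const.lattice G Y).fixSub P) :
    pointOp y f ∈ (Kind.single.lattice G Y).fixSub P := by
  have h (t) (ht : pointOp y f t ≠ 0) : t = (some y, none) := by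
    by_contra h
    exact ht (if_neg h)
  refine ⟨Kind.mem_lattice.mpr ⟨fun t ht => ?_, by simp⟩, fun t ht g hg => ?_⟩
  · rw [h t ht]
    simp [Kind.support]
  · rw [h t ht]
    exact Prod.ext (congrArg some (hy g hg)) rfl

theorem augOp_pointOp {P : Subgroup G} (y : Y) {f : Option Y × Option Y → ℤ}
    (hf : f ∈ (Kind.const.lattice G Y).fixSub P) : augOp Y (pointOp y f) = f := by
  classical
  funext t
  simp only [augOp, pointOp, AddMonoidHom.coe_mk, ZeroHom.coe_mk]
  split_ifs with h
  · rw [h]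
    simp
  · by_contra h'
    exact h ((Kind.mem_lattice.mp hf.1).1 t (Ne.symm h'))

/-- Functions of one variable as functions of two variables, as an equivariant map. -/
def pairHom (hS : ∀ P ≤ S, ∀ y y' : Y, y ≠ y' → (∀ g ∈ P, g • y = y) → (∀ g ∈ P, g • y' = y') →
    ∀ z : Y, ∀ g ∈ P, g • z = z) :
    PermLattice.Hom S (Kind.sumZero.lattice G Y) (Kind.pair.lattice G Y) where
  toFun := pairOp Y
  map_comp_smul g f := by
    ext ⟨_ | _, _ | _⟩ <;> rfl
  mem P hP f hf := by
    refine ⟨Kind.mem_lattice.mpr ⟨?_, by simp⟩, ?_⟩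
    · rintro ⟨_ | y, _ | y'⟩ ht
      · exact (ht rfl).elim
      · exact (ht rfl).elim
      · exact (ht rfl).elim
      · simp [Kind.support]
    · rintro ⟨_ | y, _ | y'⟩ ht g hg
      · exact (ht rfl).elim
      · exact (ht rfl).elim
      · exact (ht rfl).elim
      · have hfy : f (some y, none) ≠ 0 := ht
        have h0 := (Kind.mem_lattice.mp hf.1).2 rfl
        -- A function with sum zero cannot have one-point support, so P fixes two distinct points
        -- and therefore, by `hS`, all of `Y`.
        have h1 : ∃ z, z ≠ y ∧ f (some z, none) ≠ 0 := by
          by_contra! h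
          exact hfy ((Fintype.sum_eq_single y fun z hz => h z hz).symm.trans h0)
        obtain ⟨z, hz, hfz⟩ := h1
        have h2 (w) (hw : f (some w, none) ≠ 0) (g) (hg : g ∈ P) : g • w = w := by
          have := congrArg Prod.fst (hf.2 _ hw g hg)
          exact Option.some_injective _ this
        have h3 := hS P hP z y hz (h2 z hfz) (h2 y hfy)
        exact Prod.ext (congrArg some (h3 y g hg)) (congrArg some (h3 y' g hg))

/-- The difference of the marginals, as an equivariant map. -/
def diffHom : PermLattice.Hom S (Kind.pair.lattice G Y) (Kind.sumZero.lattice G Y) where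
  toFun := diffOp Y
  map_comp_smul g f := by
    ext ⟨_ | y, _ | y'⟩
    · rfl
    · rfl
    · refine congrArg₂ (fun a b : ℤ => a - b) ?_ ?_ <;>
      exact Fintype.sum_equiv (MulAction.toPerm g : Equiv.Perm Y) _ _ fun y => rfl
    · rfl
  mem P hP f hf := by
    refine ⟨Kind.mem_lattice.mpr ⟨?_, fun _ => ?_⟩, ?_⟩
    · rintro ⟨_ | y, _ | y'⟩ ht
      · exact (ht rfl).elim
      · exact (ht rfl).elim
      · simp [Kind.support]
      · exact (ht rfl).elim
    · change ∑ y, (∑ y', f (some y, some y') - ∑ y', f (some y', some y)) = 0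
      rw [Finset.sum_sub_distrib, sub_eq_zero]
      exact Finset.sum_comm
    · rintro ⟨_ | y, _ | y'⟩ ht g hg
      · exact (ht rfl).elim
      · exact (ht rfl).elim
      · have h1 : ∃ y', f (some y, some y') ≠ 0 ∨ f (some y', some y) ≠ 0 := by
          by_contra! h
          apply ht
          change ∑ y', f (some y, some y') - ∑ y', f (some y', some y) = 0
          simp [h]
        obtain ⟨y', h | h⟩ := h1
        · have := congrArg Prod.fst (hf.2 _ h g hg)
          exact Prod.ext this rfl
        · have := congrArg Prod.snd (hf.2 _ h g hg)
          exact Prod.ext this rfl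
      · exact (ht rfl).elim

/-- For the function (y, y') ↦ f(y) the first marginal is |Y| f, and the second is the constant ∑ f
= 0. -/
theorem diffOp_pairOp {f : Option Y × Option Y → ℤ} (hf : f ∈ (Kind.sumZero.lattice G Y).sub) :
    diffOp Y (pairOp Y f) = (Fintype.card Y : ℤ) • f := by
  have h := Kind.mem_lattice.mp hf
  have h0 (t) (ht : t ∉ Kind.sumZero.support Y) : f t = 0 := by
    by_contra h'
    exact ht (h.1 t h')
  ext ⟨_ | y, _ | y'⟩
  · change 0 = _ * f (none, none)
    rw [h0 _ (by simp [Kind.support]), mul_zero]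
  · change 0 = _ * f (none, some y')
    rw [h0 _ (by simp [Kind.support]), mul_zero]
  · change ∑ y' : Y, f (some y, none) - ∑ y' : Y, f (some y', none) = _ * f (some y, none)
    rw [h.2 rfl]
    simp
  · change 0 = _ * f (some y, some y')
    rw [h0 _ (by simp [Kind.support]), mul_zero]

end Kinds

/-! ### Tensor products of the building blocks -/

section KindTens

variable {ι Γ G : Type} [Group Γ] [Group G] [DecidableEq ι]

/-- The lattice of functions of several variables whose kind in the `i`-th variable is `k i`. -/
def kindTens {Y : Type} [MulAction G Y] [Fintype Y] (π : Γ →* (ι → G)) (k : ι → Kind) :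
    PermLattice Γ (Slots π (Option Y × Option Y)) :=
  PermLattice.tens π fun i => (k i).lattice G Y

variable {Y : Type} [MulAction G Y] [Fintype Y] {π : Γ →* (ι → G)} {S : Subgroup Γ}

/-- The inclusion of the functions with sum zero. -/
def inclHom {S : Subgroup G} :
    PermLattice.Hom S (Kind.sumZero.lattice G Y) (Kind.single.lattice G Y) where
  toFun := AddMonoidHom.id _
  map_comp_smul _ _ := rfl
  mem _ _ _ hf := ⟨Kind.mem_lattice.mpr ⟨(Kind.mem_lattice.mp hf.1).1, by simp⟩, hf.2⟩

theorem slot_id {L : Type} (i : ι) (f : Slots π L → ℤ) : slot i (AddMonoidHom.id _) f = f := by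
  funext x
  rw [slot_apply]
  exact congrArg f (x.update_eq_self i)

theorem slot_slot {L : Type} (i : ι) (h h' : (L → ℤ) →+ (L → ℤ)) (f : Slots π L → ℤ)
    (x : Slots π L) : slot i h (slot i h' f) x = h (h' (slice f i x)) (x i) := by
  rw [slot_apply, slice_slot_self]

/-- The augmentation sequence in the `i`-th variable. -/
theorem kindTens_shortExact (k : ι → Kind) (i : ι)
    (hY : ∀ P ≤ S, ∃ y : Y, ∀ g ∈ P.map (slotProj π i), g • y = y) :
    ∃ (f : (kindTens (Y := Y) π (Function.update k i .sumZero)).functor S ⟶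
        (kindTens (Y := Y) π (Function.update k i .single)).functor S)
      (g : (kindTens (Y := Y) π (Function.update k i .single)).functor S ⟶
        (kindTens (Y := Y) π (Function.update k i .const)).functor S)
      (w : f ≫ g = 0), (ShortComplex.mk f g w).ShortExact := by
  have hne (a b : Kind) (j : ι) (hj : j ≠ i) :
      (Function.update k i a j).lattice G Y = (Function.update k i b j).lattice G Y := by
    rw [Function.update_of_ne hj, Function.update_of_ne hj]
  have hself (a : Kind) : (Function.update k i a i).lattice G Y = a.lattice G Y := by
    rw [Function.update_self]
  let f : PermLattice.Hom S (kindTens (Y := Y) π (Function.update k i .sumZero))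
      (kindTens (Y := Y) π (Function.update k i .single)) :=
    PermLattice.slotHom i (hne _ _) (hself _) (hself _) inclHom
  let g : PermLattice.Hom S (kindTens (Y := Y) π (Function.update k i .single))
      (kindTens (Y := Y) π (Function.update k i .const)) :=
    PermLattice.slotHom i (hne _ _) (hself _) (hself _) augHom
  have hf (x) : f.toFun x = x := slot_id i x
  have hg (x) : g.toFun x = slot i (augOp Y) x := rfl
  refine ⟨f.natTrans, g.natTrans, PermLattice.shortExact f g ?_ ?_ ?_ ?_⟩
  · intro x y hxy
    rwa [hf, hf] at hxy
  · intro x hx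
    rw [hf, hg]
    funext t
    rw [slot_apply]
    have h := hx i t
    beta_reduce at h
    rw [hself] at h
    have h1 := (Kind.mem_lattice.mp h).2 rfl
    rw [augOp_eq_zero h1]
    rfl
  · intro P hP y hy h0
    refine ⟨y, ⟨fun j x => ?_, hy.2⟩, hf y⟩
    have hj := hy.1 j x
    beta_reduce at hj ⊢
    rcases eq_or_ne j i with rfl | hji
    · rw [hself] at hj ⊢
      refine Kind.mem_lattice.mpr ⟨(Kind.mem_lattice.mp hj).1, fun _ => ?_⟩
      -- The operator `augOp` records the sum at (none, none), so the kernel condition is read off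
      -- after moving the variable there.
      have h1 := congrFun h0 (x.update j (none, none))
      rw [hg, slot_apply, slice_update_self, Slots.update_self] at h1
      rwa [augOp_none] at h1
    · rw [hne _ _ j hji]
      exact hj
  · intro P hP z hz
    obtain ⟨y, hy⟩ := hY P hP
    refine ⟨slot i (pointOp y) z, PermLattice.slot_mem_fixSub (hne _ _) ?_ hz, ?_⟩
    · intro u hu
      rw [hself] at hu ⊢
      exact pointOp_mem hy hu
    · funext t
      rw [hg, slot_slot]
      have h := PermLattice.slice_mem_fixSub hz i t
      rw [hself] at h
      rw [augOp_pointOp y h, slice, Slots.update_eq_self]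

variable {F : (OrbitCat S)ᵒᵖ ⥤ AddCommGrpCat.{0}} {p : ℕ}

/-- Up to multiplication by the order of `Y`, functions with sum zero on `Y` are a direct summand of
the functions on `Y × Y`. -/
theorem extVanish_sumZero_of_pair (k : ι → Kind) (i : ι) (hF : (p : ℤ) • 𝟙 F = 0)
    (hp : IsCoprime (Fintype.card Y : ℤ) p)
    (hY : ∀ P ≤ S.map (slotProj π i), ∀ y y' : Y, y ≠ y' → (∀ g ∈ P, g • y = y) →
      (∀ g ∈ P, g • y' = y') → ∀ z : Y, ∀ g ∈ P, g • z = z)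
    (h : ExtVanish ((kindTens (Y := Y) π (Function.update k i .pair)).functor S) F) :
    ExtVanish ((kindTens (Y := Y) π (Function.update k i .sumZero)).functor S) F := by
  have hne (a b : Kind) (j : ι) (hj : j ≠ i) :
      (Function.update k i a j).lattice G Y = (Function.update k i b j).lattice G Y := by
    rw [Function.update_of_ne hj, Function.update_of_ne hj]
  have hself (a : Kind) : (Function.update k i a i).lattice G Y = a.lattice G Y := by
    rw [Function.update_self]
  let s : PermLattice.Hom S (kindTens (Y := Y) π (Function.update k i .sumZero))
      (kindTens (Y := Y) π (Function.update k i .pair)) :=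
    PermLattice.slotHom i (hne _ _) (hself _) (hself _) (pairHom hY)
  let r : PermLattice.Hom S (kindTens (Y := Y) π (Function.update k i .pair))
      (kindTens (Y := Y) π (Function.update k i .sumZero)) :=
    PermLattice.slotHom i (hne _ _) (hself _) (hself _) diffHom
  refine ExtVanish.of_sum_comp hF hp (Finset.univ : Finset Unit) _ (fun _ => s.natTrans)
    (fun _ => r.natTrans) ?_ (fun _ _ => h)
  rw [Finset.univ_unique, Finset.sum_singleton]
  apply PermLattice.functor_hom_ext_evalHom
  intro P f x
  rw [map_zsmul, smul_eq_mul]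
  have hf : slice f.1 i x ∈ (Kind.sumZero.lattice G Y).sub := by
    have := f.2.1 i x
    beta_reduce at this
    rwa [hself] at this
  change slot i (diffOp Y) (slot i (pairOp Y) f.1) x = _ * f.1 x
  rw [slot_slot, diffOp_pairOp hf, Pi.smul_apply, slice, Slots.update_eq_self, smul_eq_mul]

/-- If all variables are of permutation type, the lattice consists of all functions on a
permutation set. -/
theorem kindTens_eq_supported (k : ι → Kind) (hk : ∀ i, k i = .single ∨ k i = .pair) :
    ∃ hX, kindTens (Y := Y) π k = PermLattice.supported {x | ∀ i, x i ∈ (k i).support Y} hX := by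
  refine ⟨fun g x hx i => Kind.mem_support_of_smul _ _ _ (hx i), ?_⟩
  apply PermLattice.ext
  ext f
  refine Iff.trans (PermLattice.mem_tens (f := f)) ⟨fun h x hx i => ?_, fun h i x => ?_⟩
  · refine (Kind.mem_lattice.mp (h i x)).1 (x i) ?_
    rwa [slice, Slots.update_eq_self]
  · refine Kind.mem_lattice.mpr ⟨fun t ht => ?_, fun h' => ?_⟩
    · have := h _ ht i
      rwa [Slots.update_self] at this
    · rcases hk i with h1 | h1 <;> rw [h1] at h' <;> cases h'

end KindTens

/-! ### Vanishing of `Ext` for the building blocks on Sylow subgroups -/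

section SylowKinds

variable {ι Γ G : Type} [Group Γ] [Group G] {p : ℕ}

theorem forall_smul_sylow_iff {P : Subgroup G} (hP : IsPGroup p P) (y : Sylow p G) :
    (∀ g ∈ P, g • y = y) ↔ P ≤ y := by
  rw [← hP.sylow_mem_fixedPoints_iff, MulAction.mem_fixedPoints]
  exact ⟨fun h g => h g.1 g.2, fun h g hg => h ⟨g, hg⟩⟩

/-- The largest `p`-subgroup that fixes a pair. -/
def pairFixer (t : Option (Sylow p G) × Option (Sylow p G)) : Subgroup G :=
  (t.1.elim ⊤ fun y => y) ⊓ t.2.elim ⊤ fun y => y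

theorem pairFixer_iff {P : Subgroup G} (hP : IsPGroup p P)
    (t : Option (Sylow p G) × Option (Sylow p G)) :
    (∀ g ∈ P, g • t = t) ↔ P ≤ pairFixer t := by
  have h (o : Option (Sylow p G)) :
      (∀ g ∈ P, g • o = o) ↔ P ≤ o.elim ⊤ fun y => (y : Subgroup G) := by
    rcases o with _ | y
    · simp
    · rw [Option.elim_some, ← forall_smul_sylow_iff hP]
      simp
  rw [pairFixer, le_inf_iff, ← h, ← h]
  simp only [Prod.ext_iff, Prod.smul_fst, Prod.smul_snd, forall_and]

theorem isPGroup_pairFixer {t : Option (Sylow p G) × Option (Sylow p G)} (ht : t.1.isSome) :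
    IsPGroup p (pairFixer t) := by
  obtain ⟨y, hy⟩ := Option.isSome_iff_exists.mp ht
  refine y.2.to_le (inf_le_left.trans ?_)
  rw [hy]
  rfl

variable {π : Γ →* (ι → G)}

/-- Fixing a family means fixing each member, so the fixers in the separate variables combine. One
Sylow component in every variable is needed for the result to be a p-group. -/
theorem isFixer_slots [Finite ι] (hπ : Function.Bijective π)
    (x : Slots π (Option (Sylow p G) × Option (Sylow p G))) (hx : ∀ i, (x i).1.isSome) :
    PermLattice.IsFixer p (⨅ i, (pairFixer (x i)).comap (slotProj π i)) x := by
  constructor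
  · rintro ⟨g, hg⟩
    have := Fintype.ofFinite ι
    rw [Subgroup.mem_iInf] at hg
    have h (i : ι) : ∃ n, (slotProj π i g) ^ p ^ n = 1 := by
      obtain ⟨n, hn⟩ := isPGroup_pairFixer (hx i) ⟨_, hg i⟩
      exact ⟨n, congrArg Subtype.val hn⟩
    choose n hn using h
    -- Each pⁿⁱ divides p to the sum of the exponents, so this one power kills all components.
    refine ⟨∑ i, n i, Subtype.ext (hπ.1 ?_)⟩
    funext i
    change π (g ^ p ^ ∑ i, n i) i = π 1 i
    rw [map_pow, map_one, Pi.pow_apply, Pi.one_apply]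
    obtain ⟨m, hm⟩ := pow_dvd_pow p
      (Finset.single_le_sum (f := n) (fun _ _ => Nat.zero_le _) (Finset.mem_univ i))
    rw [hm, pow_mul]
    exact (congrArg (· ^ m) (hn i)).trans (one_pow m)
  · intro P hP
    rw [le_iInf_iff]
    simp_rw [← Subgroup.map_le_iff_le_comap, ← pairFixer_iff (hP.map _)]
    constructor
    · rintro h i _ ⟨g, hg, rfl⟩
      exact congrFun (h g hg) i
    · intro h g hg
      funext i
      exact h i _ ⟨g, hg, rfl⟩

/-- In the other variables the fixer may be an intersection of two Sylow subgroups and thus trivial.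
In variable i it is a full Sylow subgroup or all of `G`, and an element of it placed in that
variable alone lies in the total fixer. -/
theorem pairFixer_slots_ne_bot [DecidableEq ι] [Finite G] [Fact p.Prime] (hπ : Function.Bijective π) (hG : p ∣ Nat.card G)
    (x : Slots π (Option (Sylow p G) × Option (Sylow p G))) (i : ι) (hx : (x i).2 = none) :
    (⨅ i, (pairFixer (x i)).comap (slotProj π i)) ≠ ⊥ := by
  have h1 : pairFixer (x i) ≠ ⊥ := by
    rw [pairFixer, hx]
    rcases h : (x i).1 with _ | y
    · have : Nontrivial G := by
        rw [← Finite.one_lt_card_iff_nontrivial]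
        exact (Fact.out : p.Prime).one_lt.trans_le (Nat.le_of_dvd Nat.card_pos hG)
      simp
    · simpa using y.ne_bot_of_dvd_card hG
  obtain ⟨⟨a, ha⟩, ha'⟩ := Subgroup.ne_bot_iff_exists_ne_one.mp h1
  have ha1 : a ≠ 1 := fun h => ha' (Subtype.ext h)
  obtain ⟨g, hg⟩ := hπ.2 (Pi.mulSingle i a)
  intro h
  have hg1 : g ∈ ⨅ i, (pairFixer (x i)).comap (slotProj π i) := by
    rw [Subgroup.mem_iInf]
    intro j
    change π g j ∈ pairFixer (x j)
    rw [hg]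
    rcases eq_or_ne j i with rfl | hj
    · rwa [Pi.mulSingle_eq_same]
    · rw [Pi.mulSingle_eq_of_ne hj]
      exact one_mem _
  rw [h, Subgroup.mem_bot] at hg1
  rw [hg1, map_one] at hg
  apply ha1
  have := congrFun hg i
  rw [Pi.mulSingle_eq_same] at this
  exact this.symm

variable {T : Sylow p Γ}

theorem exists_fixed_sylow [Finite G] [Fact p.Prime] (i : ι) (P : Subgroup Γ) (hP : P ≤ (T : Subgroup Γ)) :
    ∃ y : Sylow p G, ∀ g ∈ P.map (slotProj π i), g • y = y := by
  have h := (T.2.to_le hP).map (slotProj π i)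
  obtain ⟨y, hy⟩ := h.exists_le_sylow
  exact ⟨y, (forall_smul_sylow_iff h y).2 hy⟩

theorem smul_eq_of_fixes_two (hTI : ∀ y y' : Sylow p G, y ≠ y' → (y : Subgroup G) ⊓ y' = ⊥)
    {P : Subgroup G} (hP : IsPGroup p P) {y y' : Sylow p G} (hne : y ≠ y')
    (hy : ∀ g ∈ P, g • y = y) (hy' : ∀ g ∈ P, g • y' = y') : P = ⊥ := by
  rw [eq_bot_iff, ← hTI y y' hne]
  exact le_inf ((forall_smul_sylow_iff hP y).1 hy) ((forall_smul_sylow_iff hP y').1 hy')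

/-- A bound for the number of steps that reduce a kind to permutation type. -/
def Kind.weight : Kind → ℕ
  | .const => 2
  | .sumZero => 1
  | .single => 0
  | .pair => 0

/-- Induction on total weight: `.const` is a quotient of `.single` by `.sumZero`, and `.sumZero` is
p-locally a summand of `.pair`. The given `.single` variable is never touched, and it makes the
fixers nontrivial once all variables are of permutation type. -/
theorem extVanish_kindTens [Fintype ι] [DecidableEq ι] [Finite Γ] [Finite G] [Fact p.Prime]
    [Fintype (Sylow p G)] (hπ : Function.Bijective π) (hG : p ∣ Nat.card G)
    (hTI : ∀ y y' : Sylow p G, y ≠ y' → (y : Subgroup G) ⊓ y' = ⊥)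
    {F : (OrbitCat (T : Subgroup Γ))ᵒᵖ ⥤ AddCommGrpCat.{0}} (hF : (p : ℤ) • 𝟙 F = 0)
    (hF0 : ∀ Q : OrbitCat (T : Subgroup Γ), Q.sub ≠ ⊥ → ∀ x : F.obj (.op Q), x = 0)
    (k : ι → Kind) (hk : ∃ i, k i = .single) :
    ExtVanish ((kindTens (Y := Sylow p G) π k).functor (T : Subgroup Γ)) F := by
  induction hn : ∑ i, (k i).weight using Nat.strong_induction_on generalizing k with
  | _ n ih =>
    subst hn
    have hlt (i : ι) (a : Kind) (ha : a.weight < (k i).weight) :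
        ∑ j, (Function.update k i a j).weight < ∑ j, (k j).weight := by
      refine Finset.sum_lt_sum (fun j _ => ?_) ⟨i, Finset.mem_univ i, ?_⟩
      · rcases eq_or_ne j i with rfl | hj
        · rw [Function.update_self]
          exact ha.le
        · rw [Function.update_of_ne hj]
      · rw [Function.update_self]
        exact ha
    obtain ⟨i₀, hi₀⟩ := hk
    have hk' (i : ι) (hi : k i ≠ .single) (a : Kind) :
        ∃ j, Function.update k i a j = .single :=
      ⟨i₀, by rw [Function.update_of_ne (by rintro rfl; exact hi hi₀), hi₀]⟩
    by_cases hperm : ∀ i, k i = .single ∨ k i = .pair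
    · obtain ⟨hX, h⟩ := kindTens_eq_supported (π := π) (Y := Sylow p G) k hperm
      rw [h]
      refine PermLattice.extVanish_supported T hF hF0 fun x hx => ⟨_, isFixer_slots hπ x ?_,
        pairFixer_slots_ne_bot hπ hG x i₀ ?_⟩
      · intro i
        have h1 := hx i
        rcases hperm i with h2 | h2 <;> rw [h2] at h1 <;> exact h1.1
      · have h1 := hx i₀
        rw [hi₀] at h1
        exact h1.2
    · push Not at hperm
      obtain ⟨i, hi1, hi2⟩ := hperm
      rcases hki : k i with _ | _ | _ | _
      · have h1 := ih _ (hlt i .sumZero (by rw [hki]; decide)) _ (hk' i hi1 _) rfl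
        have h2 := ih _ (hlt i .single (by rw [hki]; decide)) _ (hk' i hi1 _) rfl
        obtain ⟨f, g, w, hS⟩ := kindTens_shortExact (Y := Sylow p G) (π := π)
          (S := (T : Subgroup Γ)) k i fun P hP => exists_fixed_sylow i P hP
        have h3 : ExtVanish ((kindTens (Y := Sylow p G) π
            (Function.update k i .const)).functor (T : Subgroup Γ)) F :=
          ExtVanish.of_shortExact hS h1 h2
        rwa [← hki, Function.update_eq_self] at h3
      · exact (hi1 hki).elim
      · have h1 := ih _ (hlt i .pair (by rw [hki]; decide)) _ (hk' i hi1 _) rfl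
        have h3 := extVanish_sumZero_of_pair k i hF ?_ ?_ h1
        · rwa [← hki, Function.update_eq_self] at h3
        -- The number of Sylow p-subgroups is prime to p.
        · rw [Nat.isCoprime_iff_coprime, Nat.coprime_comm, Nat.Prime.coprime_iff_not_dvd Fact.out,
            ← Nat.card_eq_fintype_card]
          exact not_dvd_card_sylow p G
        · intro P hP y y' hne hy hy' z g hg
          have h4 := smul_eq_of_fixes_two hTI ((T.2.map _).to_le hP) hne hy hy'
          rw [h4, Subgroup.mem_bot] at hg
          rw [hg, one_smul]
      · exact (hi2 hki).elim

end SylowKinds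

/-! ### Dimension shifting -/

section DimensionShift

variable {ι Γ G : Type} [Group Γ] [Group G]

section Const

variable {Y : Type} [MulAction G Y] [Fintype Y] [DecidableEq ι] {π : Γ →* (ι → G)}
  {S : Subgroup Γ}

/-- The family of base points. -/
def slotsBase (π : Γ →* (ι → G)) (Y : Type) : Slots π (Option Y × Option Y) :=
  fun _ => (none, none)

omit [DecidableEq ι] [Fintype Y] in
theorem smul_slotsBase (g : Γ) : g • slotsBase π Y = slotsBase π Y := rfl

/-- The functions supported at the base point. -/
noncomputable def baseFun (π : Γ →* (ι → G)) (Y : Type) :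
    ℤ →+ (Slots π (Option Y × Option Y) → ℤ) where
  toFun z := Set.indicator {slotsBase π Y} fun _ => z
  map_zero' := Set.indicator_zero _ _
  map_add' _ _ := Set.indicator_add _ _ _

omit [MulAction G Y] [DecidableEq ι] [Fintype Y] in
theorem baseFun_base (z : ℤ) : baseFun π Y z (slotsBase π Y) = z :=
  Set.indicator_of_mem (Set.mem_singleton (slotsBase π Y)) (fun _ => z)

omit [MulAction G Y] [DecidableEq ι] [Fintype Y] in
theorem eq_slotsBase_of_baseFun {z : ℤ} {x} (hx : baseFun π Y z x ≠ 0) : x = slotsBase π Y :=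
  Set.mem_singleton_iff.mp (Set.mem_of_indicator_ne_zero (f := fun _ => z) hx)

omit [DecidableEq ι] [Fintype Y] in
theorem baseFun_smul (z : ℤ) (g : Γ) (x) : baseFun π Y z (g • x) = baseFun π Y z x := by
  classical
  simp only [baseFun, AddMonoidHom.coe_mk, ZeroHom.coe_mk, Set.indicator_apply,
    Set.mem_singleton_iff, smul_eq_iff_eq_inv_smul, smul_slotsBase]

theorem baseFun_mem (P : Subgroup Γ) (z : ℤ) :
    baseFun π Y z ∈ (kindTens (Y := Y) π (fun _ => Kind.const)).fixSub P := by
  refine ⟨fun i x => Kind.mem_lattice.mpr ⟨fun t ht => ?_, fun h => by cases h⟩, fun x hx g _ => ?_⟩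
  · have h2 := congrFun (eq_slotsBase_of_baseFun ht) i
    rwa [Slots.update_self] at h2
  · rw [eq_slotsBase_of_baseFun hx, smul_slotsBase]

theorem eq_baseFun_of_mem {f : Slots π (Option Y × Option Y) → ℤ}
    (hf : f ∈ (kindTens (Y := Y) π (fun _ => Kind.const)).sub) :
    baseFun π Y (f (slotsBase π Y)) = f := by
  have h {x} (hx : f x ≠ 0) : x = slotsBase π Y := by
    funext i
    refine (Kind.mem_lattice.mp (hf i x)).1 (x i) ?_
    rwa [slice, Slots.update_eq_self]
  funext x
  by_cases hx : x = slotsBase π Y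
  · rw [hx, baseFun_base]
  · rw [not_imp_comm.mp eq_slotsBase_of_baseFun hx, not_imp_comm.mp h hx]

/-- The constant functor is the functor of the lattice all of whose variables are constant. -/
noncomputable def constIntHom (S : Subgroup Γ) : constInt (OrbitCat S) ⟶
    (kindTens (Y := Y) π (fun _ => Kind.const)).functor S where
  app P := AddCommGrpCat.ofHom ((baseFun π Y).codRestrict _ (baseFun_mem P.unop.sub))
  naturality P Q φ := by
    ext
    apply Subtype.ext
    funext x
    exact (baseFun_smul _ _ x).symm

theorem isIso_constIntHom : IsIso (constIntHom (Y := Y) (π := π) S) := by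
  have : ∀ P, IsIso ((constIntHom (Y := Y) (π := π) S).app P) := by
    intro P
    rw [ConcreteCategory.isIso_iff_bijective]
    constructor
    · intro z z' h
      have h1 := congrFun (congrArg Subtype.val h) (slotsBase π Y)
      exact (baseFun_base _).symm.trans (h1.trans (baseFun_base _))
    · rintro ⟨f, hf⟩
      exact ⟨f (slotsBase π Y), Subtype.ext (eq_baseFun_of_mem hf.1)⟩
  exact NatIso.isIso_of_isIso_app _

end Const

variable [Finite Γ] [Finite G] {p : ℕ} [Fact p.Prime] [Fintype (Sylow p G)] {T : Sylow p Γ}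

/-- The middle term of the augmentation sequence in variable i is of kind `.single` there, so its
Ext groups vanish and the connecting map is an isomorphism. -/
theorem ext_kindTens_shift [Fintype ι] [DecidableEq ι] {π : Γ →* (ι → G)}
    (hπ : Function.Bijective π) (hG : p ∣ Nat.card G)
    (hTI : ∀ y y' : Sylow p G, y ≠ y' → (y : Subgroup G) ⊓ y' = ⊥)
    {F : (OrbitCat (T : Subgroup Γ))ᵒᵖ ⥤ AddCommGrpCat.{0}} (hF : (p : ℤ) • 𝟙 F = 0)
    (hF0 : ∀ Q : OrbitCat (T : Subgroup Γ), Q.sub ≠ ⊥ → ∀ x : F.obj (.op Q), x = 0)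
    (k : ι → Kind) (i : ι) (hk : k i = .const) (n : ℕ) :
    Nonempty (Ext ((kindTens (Y := Sylow p G) π (Function.update k i .sumZero)).functor T) F n ≃+
      Ext ((kindTens (Y := Sylow p G) π k).functor T) F (n + 1)) := by
  obtain ⟨f, g, w, hS⟩ := kindTens_shortExact (Y := Sylow p G) (π := π)
    (S := (T : Subgroup Γ)) k i fun P hP => exists_fixed_sylow i P hP
  have h : Nonempty (Ext ((kindTens (Y := Sylow p G) π
      (Function.update k i .sumZero)).functor T) F n ≃+
      Ext ((kindTens (Y := Sylow p G) π (Function.update k i .const)).functor T) F (n + 1)) :=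
    ExtVanish.nonempty_addEquiv (F := F) hS
      (extVanish_kindTens hπ hG hTI hF hF0 _ ⟨i, Function.update_self _ _ _⟩) n
  rwa [← hk, Function.update_eq_self] at h

/-- The constant functor ℤ is constant in all three variables; one shift per variable brings the
degree from 3 down to 0. -/
theorem higherLim_three_nonempty_addEquiv {π : Γ →* (Fin 3 → G)}
    (hπ : Function.Bijective π) (hG : p ∣ Nat.card G)
    (hTI : ∀ y y' : Sylow p G, y ≠ y' → (y : Subgroup G) ⊓ y' = ⊥)
    {F : (OrbitCat (T : Subgroup Γ))ᵒᵖ ⥤ AddCommGrpCat.{0}} (hF : (p : ℤ) • 𝟙 F = 0)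
    (hF0 : ∀ Q : OrbitCat (T : Subgroup Γ), Q.sub ≠ ⊥ → ∀ x : F.obj (.op Q), x = 0) :
    Nonempty (higherLim 3 F ≃+
      ((kindTens (Y := Sylow p G) π (fun _ => .sumZero)).functor (T : Subgroup Γ) ⟶ F)) := by
  obtain ⟨e⟩ := higherLim_succ_nonempty_addEquiv F 2
  have := isIso_constIntHom (Y := Sylow p G) (π := π) (S := (T : Subgroup Γ))
  let c := asIso (constIntHom (Y := Sylow p G) (π := π) (T : Subgroup Γ))
  let e' := extAddEquivOfIso c F 3
  have shift := ext_kindTens_shift (T := T) (F := F) hπ hG hTI hF hF0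
  obtain ⟨e₁⟩ := shift (fun _ => .const) 0 rfl 2
  obtain ⟨e₂⟩ := shift (Function.update (fun _ => .const) 0 .sumZero) 1 rfl 1
  obtain ⟨e₃⟩ := shift (Function.update (Function.update (fun _ => .const) 0 .sumZero) 1 .sumZero)
    2 rfl 0
  have hk : Function.update (Function.update (Function.update
      (fun _ : Fin 3 => Kind.const) 0 .sumZero) 1 .sumZero) 2 .sumZero = fun _ => .sumZero := by
    funext i
    fin_cases i <;> rfl
  rw [hk] at e₃
  exact ⟨e.trans (e'.symm.trans (e₁.symm.trans (e₂.symm.trans (e₃.symm.trans Ext.addEquiv₀))))⟩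

end DimensionShift

/-! ### Sylow subgroups of the symmetric group on `p + 1` letters -/

section SymmetricGroup

variable {p : ℕ} [hp : Fact p.Prime]

theorem factorization_factorial_succ : (p + 1).factorial.factorization p = 1 := by
  have hp' := hp.out
  obtain ⟨q, rfl⟩ : ∃ q, p = q + 1 := ⟨p - 1, by have := hp'.pos; omega⟩
  rw [Nat.factorial_succ, Nat.factorial_succ,
    Nat.factorization_mul (by omega) (by positivity), Nat.factorization_mul (by omega)
    (Nat.factorial_ne_zero _), Finsupp.add_apply, Finsupp.add_apply, hp'.factorization_self,
    Nat.factorization_eq_zero_of_not_dvd (n := q + 1 + 1),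
    Nat.factorization_eq_zero_of_not_dvd (n := q.factorial)]
  · rfl
  · rw [hp'.dvd_factorial]
    omega
  · intro h
    have := (Nat.dvd_add_right (dvd_refl (q + 1))).mp h
    exact hp'.one_lt.ne' (Nat.dvd_one.mp this)

theorem card_sylow_perm (y : Sylow p (Equiv.Perm (Fin (p + 1)))) : Nat.card y = p := by
  rw [y.card_eq_multiplicity, Nat.card_perm, Nat.card_eq_fintype_card, Fintype.card_fin,
    factorization_factorial_succ, pow_one]

theorem dvd_card_perm : p ∣ Nat.card (Equiv.Perm (Fin (p + 1))) := by
  rw [Nat.card_perm, Nat.card_eq_fintype_card, Fintype.card_fin, hp.out.dvd_factorial]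
  omega

/-- Since p² does not divide (p+1)!, Sylow subgroups have prime order. -/
theorem sylow_perm_inf_eq_bot (y y' : Sylow p (Equiv.Perm (Fin (p + 1)))) (h : y ≠ y') :
    (y : Subgroup (Equiv.Perm (Fin (p + 1)))) ⊓ y' = ⊥ := by
  have hd := Subgroup.card_dvd_of_le
    (inf_le_left : (y : Subgroup (Equiv.Perm (Fin (p + 1)))) ⊓ y' ≤ y)
  rw [card_sylow_perm, Nat.dvd_prime hp.out] at hd
  rcases hd with hd | hd
  · exact Subgroup.eq_bot_of_card_eq _ hd
  · exfalso
    apply h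
    have h1 := Subgroup.eq_of_le_of_card_ge
      (inf_le_left : (y : Subgroup (Equiv.Perm (Fin (p + 1)))) ⊓ y' ≤ y)
      (by rw [hd, card_sylow_perm])
    have h2 := Subgroup.eq_of_le_of_card_ge
      (inf_le_right : (y : Subgroup (Equiv.Perm (Fin (p + 1)))) ⊓ y' ≤ y')
      (by rw [hd, card_sylow_perm])
    exact Sylow.ext (h1.symm.trans h2)

/-- A Sylow subgroup has a fixed point and permutes the other points transitively. -/
theorem exists_sylow_fixed_point (y : Sylow p (Equiv.Perm (Fin (p + 1)))) :
    ∃ a : Fin (p + 1), (∀ t ∈ y, t a = a) ∧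
      ∀ i j : Fin (p + 1), i ≠ a → j ≠ a → ∃ t ∈ y, t i = j := by
  have hp' := hp.out
  obtain ⟨⟨σ, hσ⟩, hord⟩ := exists_prime_orderOf_dvd_card' (G := y) p (by rw [card_sylow_perm])
  rw [Subgroup.orderOf_mk] at hord
  -- Two disjoint p-cycles would need 2p letters, and p + 1 < 2p.
  have hcyc : σ.IsCycle := by
    apply Equiv.Perm.isCycle_of_prime_order'
    · rwa [hord]
    · rw [hord, Fintype.card_fin]
      have := hp'.two_le
      omega
  have hz : Subgroup.zpowers σ = y := by
    refine Subgroup.eq_of_le_of_card_ge (by simpa using hσ) ?_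
    rw [card_sylow_perm, Nat.card_zpowers, hord]
  have hsupp : σ.supportᶜ.card = 1 := by
    rw [Finset.card_compl, ← hcyc.orderOf, hord, Fintype.card_fin]
    omega
  obtain ⟨a, ha⟩ := Finset.card_eq_one.mp hsupp
  have hmem (i : Fin (p + 1)) : σ i = i ↔ i = a := by
    have h : i ∈ σ.supportᶜ ↔ i = a := by rw [ha, Finset.mem_singleton]
    rw [← h, Finset.mem_compl, Equiv.Perm.mem_support, not_not]
  refine ⟨a, fun t ht => ?_, fun i j hi hj => ?_⟩
  · change t ∈ (y : Subgroup (Equiv.Perm (Fin (p + 1)))) at ht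
    rw [← hz] at ht
    obtain ⟨n, rfl⟩ := Subgroup.mem_zpowers_iff.mp ht
    exact Equiv.Perm.zpow_apply_eq_self_of_apply_eq_self ((hmem a).2 rfl) n
  · obtain ⟨n, hn⟩ := hcyc.sameCycle (mt (hmem i).1 hi) (mt (hmem j).1 hj)
    refine ⟨σ ^ n, ?_, hn⟩
    change _ ∈ (y : Subgroup (Equiv.Perm (Fin (p + 1))))
    rw [← hz]
    exact Subgroup.mem_zpowers_iff.mpr ⟨n, rfl⟩

/-- The fixed point of a Sylow subgroup. -/
noncomputable def sylowPoint (y : Sylow p (Equiv.Perm (Fin (p + 1)))) : Fin (p + 1) :=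
  (exists_sylow_fixed_point y).choose

theorem apply_sylowPoint {y : Sylow p (Equiv.Perm (Fin (p + 1)))} {t : Equiv.Perm (Fin (p + 1))}
    (ht : t ∈ y) : t (sylowPoint y) = sylowPoint y :=
  (exists_sylow_fixed_point y).choose_spec.1 t ht

theorem exists_sylow_apply_eq (y : Sylow p (Equiv.Perm (Fin (p + 1)))) {i j : Fin (p + 1)}
    (hi : i ≠ sylowPoint y) (hj : j ≠ sylowPoint y) : ∃ t ∈ y, t i = j :=
  (exists_sylow_fixed_point y).choose_spec.2 i j hi hj

omit hp in
theorem exists_ne_ne (hp : p.Prime) (i j : Fin (p + 1)) : ∃ l, l ≠ i ∧ l ≠ j := by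
  have h : ({i, j} : Finset (Fin (p + 1))).card < (Finset.univ : Finset (Fin (p + 1))).card := by
    rw [Finset.card_fin]
    have := Finset.card_le_two (a := i) (b := j)
    have := hp.two_le
    omega
  obtain ⟨l, -, hl⟩ := Finset.exists_mem_notMem_of_card_lt_card h
  exact ⟨l, by simpa using hl⟩

theorem eq_sylowPoint {y : Sylow p (Equiv.Perm (Fin (p + 1)))} {i : Fin (p + 1)}
    (h : ∀ t ∈ y, t i = i) : i = sylowPoint y := by
  by_contra hi
  obtain ⟨j, hj, hj'⟩ := exists_ne_ne hp.out (sylowPoint y) i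
  obtain ⟨t, ht, hti⟩ := exists_sylow_apply_eq y hi hj
  exact hj' (hti.symm.trans (h t ht))

theorem sylowPoint_smul (g : Equiv.Perm (Fin (p + 1))) (y : Sylow p (Equiv.Perm (Fin (p + 1)))) :
    sylowPoint (g • y) = g (sylowPoint y) := by
  symm
  apply eq_sylowPoint
  rintro _ ⟨t, ht, rfl⟩
  change (g * t * g⁻¹) (g (sylowPoint y)) = _
  simp [apply_sylowPoint (y := y) ht]

end SymmetricGroup

/-! ### Morphisms to atomic functors -/

section AtomicHom

variable {k Γ M Ω : Type} [CommRing k] [Group Γ] [AddCommGroup M] [Module k M] [MulAction Γ Ω]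
  {S : Subgroup Γ} {ρ : Representation k Γ M} {B : PermLattice Γ Ω}

theorem atomicFunctor_obj_eq_zero {Q : OrbitCat S} (hQ : Q.sub ≠ ⊥)
    (x : (atomicFunctor S ρ).obj (.op Q)) : x = 0 := by
  change atomicVal M Q.sub at x
  exact Subtype.ext (eq_zero_of_mem_atomicVal hQ x.2)

theorem zsmul_id_atomicFunctor {p : ℕ} (hM : ∀ m : M, (p : ℤ) • m = 0) :
    (p : ℤ) • 𝟙 (atomicFunctor S ρ) = 0 := by
  ext P x
  change (p : ℤ) • x = 0
  change atomicVal M P.unop.sub at x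
  change (p : ℤ) • x = 0
  exact Subtype.ext (hM x.1)

/-- The trivial subgroup as an object of the orbit category. -/
def OrbitCat.bot (S : Subgroup Γ) : OrbitCat S := ⟨⊥, bot_le⟩

theorem OrbitCat.rep_homOfConj_bot (g : Γ) (h) :
    OrbitCat.rep (OrbitCat.homOfConj (P := OrbitCat.bot S) (Q := OrbitCat.bot S) g h) = g := by
  have h1 := OrbitCat.toMap_homOfConj (P := OrbitCat.bot S) (Q := OrbitCat.bot S) g h
  rw [OrbitCat.toMap_mk, one_mul, QuotientGroup.eq] at h1
  exact inv_mul_eq_one.mp (Subgroup.mem_bot.mp h1)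

theorem PermLattice.mem_fixSub_bot {f : Ω → ℤ} (hf : f ∈ B.sub) : f ∈ B.fixSub ⊥ :=
  ⟨hf, fun x _ g hg => by rw [Subgroup.mem_bot.mp hg, one_smul]⟩

/-- The additive map to `M` given by a morphism to an atomic functor. -/
noncomputable def atomicHomVal (α : B.functor S ⟶ atomicFunctor S ρ) : B.fixSub ⊥ →+ M :=
  (AddSubgroup.subtype (atomicVal M (⊥ : Subgroup Γ))).comp
    (α.app (.op (OrbitCat.bot S))).hom

/-- Naturality with respect to the endomorphisms of the trivial subgroup, which are the elements of
Γ, is equivariance. -/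
theorem atomicHomVal_comp_inv_smul (α : B.functor S ⟶ atomicFunctor S ρ) (g : Γ)
    (f f' : B.fixSub (⊥ : Subgroup Γ)) (h : ∀ x, f'.1 x = f.1 (g⁻¹ • x)) :
    atomicHomVal α f' = ρ g (atomicHomVal α f) := by
  have hg : ∀ h ∈ (OrbitCat.bot S).sub, g⁻¹ * h * g ∈ (OrbitCat.bot S).sub := by
    intro h hh
    rw [Subgroup.mem_bot.mp hh]
    simp [OrbitCat.bot]
  let φ := OrbitCat.homOfConj (P := OrbitCat.bot S) (Q := OrbitCat.bot S) g hg
  have h1 := congrArg Subtype.val (NatTrans.naturality_apply α φ.op f)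
  have h2 : ((B.functor S).map φ.op f) = f' := by
    apply Subtype.ext
    funext x
    refine Eq.trans ?_ (h x).symm
    change f.1 ((OrbitCat.rep φ)⁻¹ • x) = _
    rw [OrbitCat.rep_homOfConj_bot]
  rw [h2] at h1
  refine h1.trans ?_
  change ρ (OrbitCat.rep φ) (atomicHomVal α f) = _
  rw [OrbitCat.rep_homOfConj_bot]

theorem eq_zero_of_atomicHomVal {α : B.functor S ⟶ atomicFunctor S ρ}
    (h : ∀ f, atomicHomVal α f = 0) : α = 0 := by
  ext ⟨P⟩ f
  by_cases hP : P.sub = ⊥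
  · obtain rfl : P = OrbitCat.bot S := OrbitCat.ext hP
    exact Subtype.ext (h f)
  · exact atomicFunctor_obj_eq_zero hP _

/-- The morphism to an atomic functor given by an equivariant map. -/
noncomputable def atomicHomOfEquivariant (θ : (Ω → ℤ) →+ M)
    (hθ : ∀ (g : Γ) (f : Ω → ℤ), θ (fun x => f (g⁻¹ • x)) = ρ g (θ f))
    (hB : ∀ P ≤ S, P ≠ ⊥ → ∀ f ∈ B.fixSub P, f = 0) : B.functor S ⟶ atomicFunctor S ρ where
  app P := AddCommGrpCat.ofHom
    ((θ.comp (B.fixSub P.unop.sub).subtype).codRestrict (atomicVal M P.unop.sub) fun f => by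
      by_cases hP : P.unop.sub = ⊥
      · simp [atomicVal, hP]
      · change θ f.1 ∈ _
        rw [hB _ P.unop.le hP f.1 f.2, map_zero]
        exact zero_mem _)
  naturality P Q φ := by
    ext f
    exact Subtype.ext (hθ _ _)

theorem atomicHomVal_atomicHomOfEquivariant (θ : (Ω → ℤ) →+ M)
    (hθ : ∀ (g : Γ) (f : Ω → ℤ), θ (fun x => f (g⁻¹ • x)) = ρ g (θ f))
    (hB : ∀ P ≤ S, P ≠ ⊥ → ∀ f ∈ B.fixSub P, f = 0) (f : B.fixSub (⊥ : Subgroup Γ)) :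
    atomicHomVal (atomicHomOfEquivariant θ hθ hB) f = θ f.1 := rfl

end AtomicHom

/-! ### Functions of three variables with sum zero -/

section ThreeVariables

variable {Γ G Y : Type} [Group Γ] [Group G] {π : Γ →* (Fin 3 → G)}

/-- The family with three given members. -/
def slots₃ (π : Γ →* (Fin 3 → G)) {L : Type} (s t r : L) : Slots π L := ![s, t, r]

theorem slots₃_eta {L : Type} (x : Slots π L) : slots₃ π (x 0) (x 1) (x 2) = x := by
  funext i
  fin_cases i <;> rfl

theorem slice_slots₃ {L : Type} (f : Slots π L → ℤ) (s t r : L) :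
    slice f 0 (slots₃ π s t r) = (fun l => f (slots₃ π l t r)) ∧
    slice f 1 (slots₃ π s t r) = (fun l => f (slots₃ π s l r)) ∧
    slice f 2 (slots₃ π s t r) = (fun l => f (slots₃ π s t l)) := by
  refine ⟨?_, ?_, ?_⟩ <;>
  · funext l
    refine congrArg f (funext fun i => ?_)
    fin_cases i <;> rfl

theorem smul_slots₃ {L : Type} [MulAction G L] (g : Γ) (s t r : L) :
    g • slots₃ π s t r =
      slots₃ π (slotProj π 0 g • s) (slotProj π 1 g • t) (slotProj π 2 g • r) := by
  funext i
  fin_cases i <;> rfl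

/-- The product of three functions of one variable. -/
def prod₃ (π : Γ →* (Fin 3 → G)) {L : Type} (u v w : L → ℤ) : Slots π L → ℤ :=
  fun x => u (x 0) * v (x 1) * w (x 2)

variable [MulAction G Y] [Fintype Y]

theorem prod₃_mem {u v w : Option Y × Option Y → ℤ} {k : Kind} (hu : u ∈ (k.lattice G Y).sub)
    (hv : v ∈ (k.lattice G Y).sub) (hw : w ∈ (k.lattice G Y).sub) :
    prod₃ π u v w ∈ (kindTens (Y := Y) π fun _ => k).sub := by
  intro i x
  rw [← slots₃_eta x]
  obtain ⟨h0, h1, h2⟩ := slice_slots₃ (prod₃ π u v w) (x 0) (x 1) (x 2)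
  fin_cases i
  · refine h0 ▸ ?_
    convert zsmul_mem hu (v (x 1) * w (x 2)) using 1
    funext l
    change u l * v (x 1) * w (x 2) = (v (x 1) * w (x 2)) * u l
    ring
  · refine h1 ▸ ?_
    convert zsmul_mem hv (u (x 0) * w (x 2)) using 1
    funext l
    change u (x 0) * v l * w (x 2) = (u (x 0) * w (x 2)) * v l
    ring
  · refine h2 ▸ ?_
    exact zsmul_mem hw (u (x 0) * v (x 1))

open Classical in
/-- The function `1 - |Y| δ_a` on `Y`. -/
noncomputable def devFun (a : Y) : Option Y × Option Y → ℤ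
  | (some b, none) => 1 - if b = a then (Fintype.card Y : ℤ) else 0
  | (some _, some _) => 0
  | (none, _) => 0

theorem devFun_mem (a : Y) : devFun a ∈ (Kind.sumZero.lattice G Y).sub := by
  classical
  refine Kind.mem_lattice.mpr ⟨?_, fun _ => ?_⟩
  · rintro ⟨_ | b, _ | c⟩ h
    · exact (h rfl).elim
    · exact (h rfl).elim
    · simp [Kind.support]
    · exact (h rfl).elim
  · simp [devFun]

theorem devFun_smul (g : G) (a : Y) (t : Option Y × Option Y) :
    devFun (g • a) t = devFun a (g⁻¹ • t) := by
  rcases t with ⟨_ | b, _ | c⟩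
  · rfl
  · rfl
  · have h : g⁻¹ • b = a ↔ b = g • a := inv_smul_eq_iff
    classical
    change (1 : ℤ) - (if b = g • a then _ else _) = 1 - (if g⁻¹ • b = a then _ else _)
    simp only [h]
  · rfl

/-- The constant part of `devFun` contributes ∑ u = 0. So, up to the factor -|Y|, the functions
`devFun a` generate the functions with sum zero, and unlike differences δ_a - δ_b each is fixed by
the stabilizer of a point. -/
theorem sum_mul_devFun {u : Option Y × Option Y → ℤ} (hu : u ∈ (Kind.sumZero.lattice G Y).sub)
    (t : Option Y × Option Y) :
    ∑ a, u (some a, none) * devFun a t = -(Fintype.card Y : ℤ) * u t := by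
  classical
  have h := Kind.mem_lattice.mp hu
  have h0 (t) (ht : t ∉ Kind.sumZero.support Y) : u t = 0 := by
    by_contra h'
    exact ht (h.1 t h')
  rcases t with ⟨_ | b, _ | c⟩
  · rw [h0 _ (by simp [Kind.support])]
    simp [devFun]
  · rw [h0 _ (by simp [Kind.support])]
    simp [devFun]
  · simp only [devFun, mul_sub, mul_one, Finset.sum_sub_distrib, h.2 rfl]
    simp
    ring
  · rw [h0 _ (by simp [Kind.support])]
    simp [devFun]

theorem sum_prod₃_devFun {f : Slots π (Option Y × Option Y) → ℤ}
    (hf : f ∈ (kindTens (Y := Y) π fun _ => .sumZero).sub) :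
    ∑ a, ∑ b, ∑ c, f (slots₃ π (some a, none) (some b, none) (some c, none)) •
      prod₃ π (devFun a) (devFun b) (devFun c) = (-(Fintype.card Y : ℤ)) ^ 3 • f := by
  have h0 (s t r) : ∑ a, f (slots₃ π (some a, none) t r) * devFun a s =
      -(Fintype.card Y : ℤ) * f (slots₃ π s t r) :=
    sum_mul_devFun (G := G) (u := fun l => f (slots₃ π l t r))
      ((slice_slots₃ f s t r).1 ▸ hf 0 (slots₃ π s t r)) s
  have h1 (s t r) : ∑ b, f (slots₃ π s (some b, none) r) * devFun b t =
      -(Fintype.card Y : ℤ) * f (slots₃ π s t r) :=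
    sum_mul_devFun (G := G) (u := fun l => f (slots₃ π s l r))
      ((slice_slots₃ f s t r).2.1 ▸ hf 1 (slots₃ π s t r)) t
  have h2 (s t r) : ∑ c, f (slots₃ π s t (some c, none)) * devFun c r =
      -(Fintype.card Y : ℤ) * f (slots₃ π s t r) :=
    sum_mul_devFun (G := G) (u := fun l => f (slots₃ π s t l))
      ((slice_slots₃ f s t r).2.2 ▸ hf 2 (slots₃ π s t r)) r
  funext x
  simp only [Finset.sum_apply, Pi.smul_apply, smul_eq_mul, prod₃]
  set N : ℤ := -(Fintype.card Y : ℤ)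
  calc ∑ a, ∑ b, ∑ c, f (slots₃ π (some a, none) (some b, none) (some c, none)) *
        (devFun a (x 0) * devFun b (x 1) * devFun c (x 2))
      = ∑ a, ∑ b, (∑ c, f (slots₃ π (some a, none) (some b, none) (some c, none)) *
        devFun c (x 2)) * devFun b (x 1) * devFun a (x 0) := by
        refine Finset.sum_congr rfl fun a _ => Finset.sum_congr rfl fun b _ => ?_
        rw [Finset.sum_mul, Finset.sum_mul]
        refine Finset.sum_congr rfl fun c _ => ?_
        ring
    _ = ∑ a, (∑ b, f (slots₃ π (some a, none) (some b, none) (x 2)) * devFun b (x 1)) *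
        (N * devFun a (x 0)) := by
        refine Finset.sum_congr rfl fun a _ => ?_
        rw [Finset.sum_mul]
        refine Finset.sum_congr rfl fun b _ => ?_
        rw [h2]
        ring
    _ = (∑ a, f (slots₃ π (some a, none) (x 1) (x 2)) * devFun a (x 0)) * (N * N) := by
        rw [Finset.sum_mul]
        refine Finset.sum_congr rfl fun a _ => ?_
        rw [h1]
        ring
    _ = N ^ 3 * f x := by
        rw [h0, slots₃_eta]
        ring

variable {k M : Type} [CommRing k] [AddCommGroup M] [Module k M] {S : Subgroup Γ}
  {ρ : Representation k Γ M}

/-- The value of a morphism at the product of the functions `1 - |Y| δ_a`. -/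
noncomputable def devVal
    (α : (kindTens (Y := Y) π fun _ => .sumZero).functor S ⟶ atomicFunctor S ρ) (a b c : Y) : M :=
  atomicHomVal α ⟨prod₃ π (devFun a) (devFun b) (devFun c),
    PermLattice.mem_fixSub_bot (prod₃_mem (devFun_mem a) (devFun_mem b) (devFun_mem c))⟩

theorem devVal_smul (α : (kindTens (Y := Y) π fun _ => .sumZero).functor S ⟶ atomicFunctor S ρ)
    (g : Γ) (a b c : Y) :
    devVal α (slotProj π 0 g • a) (slotProj π 1 g • b) (slotProj π 2 g • c) =
      ρ g (devVal α a b c) := by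
  refine atomicHomVal_comp_inv_smul α g _ _ fun x => ?_
  simp only [prod₃, devFun_smul, Slots.smul_apply, map_inv]

/-- Transitivity in each variable moves (y, y, y) to any triple, and the triple products generate
the lattice up to the cube of |Y|, which is invertible on a group killed by p. -/
theorem eq_zero_of_devVal {p : ℕ} (hM : ∀ m : M, (p : ℤ) • m = 0)
    (hp : IsCoprime (Fintype.card Y : ℤ) p) [MulAction.IsPretransitive G Y]
    (hπ : Function.Surjective π)
    {α : (kindTens (Y := Y) π fun _ => .sumZero).functor S ⟶ atomicFunctor S ρ} (y : Y)
    (h : devVal α y y y = 0) : α = 0 := by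
  have hall (a b c : Y) : devVal α a b c = 0 := by
    obtain ⟨g₀, rfl⟩ := MulAction.exists_smul_eq G y a
    obtain ⟨g₁, rfl⟩ := MulAction.exists_smul_eq G y b
    obtain ⟨g₂, rfl⟩ := MulAction.exists_smul_eq G y c
    obtain ⟨g, hg⟩ := hπ ![g₀, g₁, g₂]
    have h0 : slotProj π 0 g = g₀ := congrFun hg 0
    have h1 : slotProj π 1 g = g₁ := congrFun hg 1
    have h2 : slotProj π 2 g = g₂ := congrFun hg 2
    rw [← h0, ← h1, ← h2, devVal_smul, h, map_zero]
  apply eq_zero_of_atomicHomVal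
  intro f
  have h1 : (-(Fintype.card Y : ℤ)) ^ 3 • f = ∑ a, ∑ b, ∑ c,
      f.1 (slots₃ π (some a, none) (some b, none) (some c, none)) •
        (⟨prod₃ π (devFun a) (devFun b) (devFun c), PermLattice.mem_fixSub_bot
          (prod₃_mem (devFun_mem a) (devFun_mem b) (devFun_mem c))⟩ :
          (kindTens (Y := Y) π fun _ => .sumZero).fixSub ⊥) := by
    apply Subtype.ext
    have := sum_prod₃_devFun f.2.1
    push_cast
    exact this.symm
  have h2 : (-(Fintype.card Y : ℤ)) ^ 3 • atomicHomVal α f = 0 := by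
    rw [← map_zsmul, h1]
    simp only [map_sum, map_zsmul]
    refine Finset.sum_eq_zero fun a _ => Finset.sum_eq_zero fun b _ =>
      Finset.sum_eq_zero fun c _ => ?_
    have := hall a b c
    rw [devVal] at this
    rw [this, smul_zero]
  obtain ⟨r, s, hrs⟩ := (hp.neg_left).pow_left (m := 3)
  calc atomicHomVal α f = (r * (-(Fintype.card Y : ℤ)) ^ 3 + s * p) • atomicHomVal α f := by
        rw [hrs, one_smul]
    _ = 0 := by rw [add_smul, mul_smul, mul_smul, h2, hM]; simp

/-- Summation of a function of three variables against a family of tensors. -/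
noncomputable def pairing (π : Γ →* (Fin 3 → G)) (e : Y → Y → Y → M) :
    (Slots π (Option Y × Option Y) → ℤ) →+ M where
  toFun f := ∑ a, ∑ b, ∑ c, f (slots₃ π (some a, none) (some b, none) (some c, none)) • e a b c
  map_zero' := by simp
  map_add' f f' := by simp [add_smul, Finset.sum_add_distrib]

theorem pairing_comp_inv_smul {e : Y → Y → Y → M} (he : ∀ (g : Γ) (a b c : Y),
      ρ g (e a b c) = e (slotProj π 0 g • a) (slotProj π 1 g • b) (slotProj π 2 g • c))
    (g : Γ) (f : Slots π (Option Y × Option Y) → ℤ) :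
    pairing π e (fun x => f (g⁻¹ • x)) = ρ g (pairing π e f) := by
  simp only [pairing, AddMonoidHom.coe_mk, ZeroHom.coe_mk, map_sum, map_zsmul, he]
  rw [← Equiv.sum_comp (MulAction.toPerm (slotProj π 0 g) : Equiv.Perm Y)]
  refine Finset.sum_congr rfl fun a _ => ?_
  rw [← Equiv.sum_comp (MulAction.toPerm (slotProj π 1 g) : Equiv.Perm Y)]
  refine Finset.sum_congr rfl fun b _ => ?_
  rw [← Equiv.sum_comp (MulAction.toPerm (slotProj π 2 g) : Equiv.Perm Y)]
  refine Finset.sum_congr rfl fun c _ => ?_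
  simp [smul_slots₃]

end ThreeVariables

/-! ### Vanishing of the sum-zero functor away from the trivial subgroup -/

section SumZeroSupport

variable {ι Γ G : Type} [Group Γ] [Group G] [DecidableEq ι] {p : ℕ}
  [Fintype (Sylow p G)] {T : Sylow p Γ} {π : Γ →* (ι → G)}

/-- Some projection of P is nontrivial. A nonzero slice in that variable has sum zero, hence at
least two Sylow subgroups in its support, and a p-group that normalizes both is trivial. -/
theorem sumZero_eq_zero (hπ : Function.Injective π)
    (hTI : ∀ y y' : Sylow p G, y ≠ y' → (y : Subgroup G) ⊓ y' = ⊥) (P : Subgroup Γ)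
    (hP : P ≤ (T : Subgroup Γ)) (hP0 : P ≠ ⊥)
    (f : Slots π (Option (Sylow p G) × Option (Sylow p G)) → ℤ)
    (hf : f ∈ (kindTens (Y := Sylow p G) π fun _ => .sumZero).fixSub P) : f = 0 := by
  obtain ⟨⟨g, hg⟩, hg1⟩ := Subgroup.ne_bot_iff_exists_ne_one.mp hP0
  obtain ⟨i, hi⟩ : ∃ i, slotProj π i g ≠ 1 := by
    by_contra! h
    exact hg1 (Subtype.ext (hπ ((funext h).trans (map_one π).symm)))
  funext x
  by_contra hx
  have hs := PermLattice.slice_mem_fixSub hf i x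
  have hs1 := Kind.mem_lattice.mp hs.1
  have hxi : slice f i x (x i) ≠ 0 := by
    rwa [slice, Slots.update_eq_self]
  obtain ⟨y, hy⟩ : ∃ y, x i = (some y, none) := by
    have h1 := hs1.1 _ hxi
    obtain ⟨y, hy⟩ := Option.isSome_iff_exists.mp h1.1
    exact ⟨y, Prod.ext hy h1.2⟩
  rw [hy] at hxi
  obtain ⟨z, hz, hfz⟩ : ∃ z, z ≠ y ∧ slice f i x (some z, none) ≠ 0 := by
    by_contra! h
    exact hxi ((Fintype.sum_eq_single y fun z hz => h z hz).symm.trans (hs1.2 rfl))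
  have h2 (w) (hw : slice f i x (some w, none) ≠ 0) (g) (hg : g ∈ P.map (slotProj π i)) :
      g • w = w :=
    Option.some_injective _ (congrArg Prod.fst (hs.2 _ hw g hg))
  have h3 := smul_eq_of_fixes_two hTI ((T.2.to_le hP).map (slotProj π i)) hz (h2 z hfz) (h2 y hxi)
  have h4 : slotProj π i g ∈ P.map (slotProj π i) := ⟨g, hg, rfl⟩
  rw [h3, Subgroup.mem_bot] at h4
  exact hi h4

end SumZeroSupport

/-! ### Coordinates on the natural module -/

section NaturalModule

variable {p : ℕ} [hp : Fact p.Prime]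

/-- The coordinates `f j - f a`, `j ≠ a`, of the class of `f` in the natural module. -/
def natCoord (a : Fin (p + 1)) : NatMod p →ₗ[ZMod p] ({j : Fin (p + 1) // j ≠ a} → ZMod p) :=
  (diagonalLine p).liftQ
    { toFun := fun f j => f j - f a
      map_add' := fun f g => funext fun j => add_sub_add_comm _ _ _ _
      map_smul' := fun c f => funext fun j => (mul_sub c _ _).symm } <| by
    rw [diagonalLine, Submodule.span_le, Set.singleton_subset_iff]
    exact funext fun j => sub_self 1

theorem natCoord_mk (a : Fin (p + 1)) (f : Fin (p + 1) → ZMod p) (j) :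
    natCoord a (Submodule.Quotient.mk f) j = f j - f a := rfl

theorem natCoord_injective (a : Fin (p + 1)) : Function.Injective (natCoord (p := p) a) := by
  rw [injective_iff_map_eq_zero]
  intro v hv
  obtain ⟨f, rfl⟩ := Submodule.Quotient.mk_surjective _ v
  rw [Submodule.Quotient.mk_eq_zero, diagonalLine, Submodule.mem_span_singleton]
  refine ⟨f a, funext fun j => ?_⟩
  by_cases h : j = a
  · simp [h]
  · have := congrFun hv ⟨j, h⟩
    rw [natCoord_mk, Pi.zero_apply, sub_eq_zero] at this
    simp [this]

/-- The stabilizer of the letter a permutes the coordinates with base point a. With a the fixed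
letter of a Sylow subgroup, the permutation is transitive. -/
theorem natCoord_natRep {a : Fin (p + 1)} {t : Equiv.Perm (Fin (p + 1))} (ht : t a = a)
    {i j : {j : Fin (p + 1) // j ≠ a}} (h : t i = j) (v : NatMod p) :
    natCoord a (natRep p t v) j = natCoord a v i := by
  obtain ⟨f, rfl⟩ := Submodule.Quotient.mk_surjective _ v
  change f (t⁻¹ j) - f (t⁻¹ a) = f i - f a
  rw [← h, Equiv.Perm.inv_eq_iff_eq.mpr ht.symm]
  simp

/-- The basis of the natural module dual to the coordinates. -/
noncomputable def natBasis (a : Fin (p + 1)) :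
    Module.Basis {j : Fin (p + 1) // j ≠ a} (ZMod p) (NatMod p) :=
  .ofEquivFun <| LinearEquiv.ofInjectiveOfFinrankEq (natCoord a) (natCoord_injective a) <| by
    rw [finrank_natMod, Module.finrank_fintype_fun_eq_card, Fintype.card_subtype_compl]
    simp

theorem natBasis_repr (a : Fin (p + 1)) (v : NatMod p) (j) :
    (natBasis a).repr v j = natCoord a v j := rfl

/-- The basis of the triple tensor product. -/
noncomputable def natBasis₃ (a : Fin (p + 1)) :=
  (natBasis a).tensorProduct ((natBasis a).tensorProduct (natBasis a))

theorem natBasis₃_repr_tmul (a : Fin (p + 1)) (u v w : NatMod p) (i j l) :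
    (natBasis₃ a).repr (u ⊗ₜ (v ⊗ₜ w)) (i, j, l) =
      natCoord a w l * natCoord a v j * natCoord a u i := by
  simp [natBasis₃, natBasis_repr]

/-- The triple tensor product of the natural representation. -/
noncomputable abbrev natRep₃ (p : ℕ) :=
  outerTensor (natRep p) (outerTensor (natRep p) (natRep p))

theorem natRep₃_tmul (g : Equiv.Perm (Fin (p + 1)) × Equiv.Perm (Fin (p + 1)) ×
    Equiv.Perm (Fin (p + 1))) (u v w : NatMod p) :
    natRep₃ p g (u ⊗ₜ (v ⊗ₜ w)) = natRep p g.1 u ⊗ₜ (natRep p g.2.1 v ⊗ₜ natRep p g.2.2 w) := rfl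

theorem natBasis₃_repr_natRep₃ {a : Fin (p + 1)}
    {g : Equiv.Perm (Fin (p + 1)) × Equiv.Perm (Fin (p + 1)) × Equiv.Perm (Fin (p + 1))}
    (h0 : g.1 a = a) (h1 : g.2.1 a = a) (h2 : g.2.2 a = a)
    {i j l i' j' l' : {j : Fin (p + 1) // j ≠ a}} (hi : g.1 i = i') (hj : g.2.1 j = j')
    (hl : g.2.2 l = l') (m : NatMod p ⊗[ZMod p] (NatMod p ⊗[ZMod p] NatMod p)) :
    (natBasis₃ a).repr (natRep₃ p g m) (i', j', l') = (natBasis₃ a).repr m (i, j, l) := by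
  induction m using TensorProduct.induction_on with
  | zero => simp
  | add x y hx hy => rw [map_add, map_add, map_add, Finsupp.add_apply, Finsupp.add_apply, hx, hy]
  | tmul u x =>
    induction x using TensorProduct.induction_on with
    | zero => simp
    | add x y hx hy =>
      rw [TensorProduct.tmul_add, map_add, map_add, map_add, Finsupp.add_apply, Finsupp.add_apply,
        hx, hy]
    | tmul v w =>
      rw [natRep₃_tmul, natBasis₃_repr_tmul, natBasis₃_repr_tmul, natCoord_natRep h0 hi,
        natCoord_natRep h1 hj, natCoord_natRep h2 hl]

/-- The class of the basis vector at the fixed point of a Sylow subgroup. -/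
noncomputable def sylowVec (y : Sylow p (Equiv.Perm (Fin (p + 1)))) : NatMod p :=
  Submodule.Quotient.mk (Pi.single (sylowPoint y) 1)

theorem natRep_sylowVec (g : Equiv.Perm (Fin (p + 1))) (y : Sylow p (Equiv.Perm (Fin (p + 1)))) :
    natRep p g (sylowVec y) = sylowVec (g • y) := by
  rw [sylowVec, sylowVec, sylowPoint_smul]
  change Submodule.Quotient.mk (fun j => Pi.single (M := fun _ => ZMod p) (sylowPoint y) 1 (g⁻¹ j))
    = _
  congr 1
  funext j
  simp only [Pi.single_apply, Equiv.Perm.inv_eq_iff_eq]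

theorem zsmul_natMod₃ (m : NatMod p ⊗[ZMod p] (NatMod p ⊗[ZMod p] NatMod p)) :
    (p : ℤ) • m = 0 := by
  rw [← Int.cast_smul_eq_zsmul (ZMod p)]
  simp

end NaturalModule

/-! ### Computation of the group of morphisms -/

section Main

variable {p : ℕ} [hp : Fact p.Prime]

/-- The identification of a triple product with a power. -/
def prodToPi₃ (G : Type) [Group G] : G × G × G →* (Fin 3 → G) where
  toFun g := ![g.1, g.2.1, g.2.2]
  map_one' := by funext i; fin_cases i <;> rfl
  map_mul' g h := by funext i; fin_cases i <;> rfl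

theorem prodToPi₃_bijective (G : Type) [Group G] : Function.Bijective (prodToPi₃ G) :=
  ⟨fun _ _ h => Prod.ext (congrFun h 0) (Prod.ext (congrFun h 1) (congrFun h 2)),
    fun x => ⟨(x 0, x 1, x 2), by funext i; fin_cases i <;> rfl⟩⟩

/-- The tensor of the classes of three Sylow subgroups. -/
noncomputable def sylowVec₃ (a b c : Sylow p (Equiv.Perm (Fin (p + 1)))) :
    NatMod p ⊗[ZMod p] (NatMod p ⊗[ZMod p] NatMod p) :=
  sylowVec a ⊗ₜ (sylowVec b ⊗ₜ sylowVec c)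

theorem natRep₃_sylowVec₃ (g) (a b c : Sylow p (Equiv.Perm (Fin (p + 1)))) :
    natRep₃ p g (sylowVec₃ a b c) = sylowVec₃ (slotProj (prodToPi₃ _) 0 g • a)
      (slotProj (prodToPi₃ _) 1 g • b) (slotProj (prodToPi₃ _) 2 g • c) := by
  rw [sylowVec₃, natRep₃_tmul, natRep_sylowVec, natRep_sylowVec, natRep_sylowVec]
  rfl

variable [Fintype (Sylow p (Equiv.Perm (Fin (p + 1))))]
  {S : Subgroup (Equiv.Perm (Fin (p + 1)) × Equiv.Perm (Fin (p + 1)) × Equiv.Perm (Fin (p + 1)))}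

/-- Morphisms from the functor of functions with sum zero in each variable to the atomic functor
of the triple tensor product. -/
abbrev TripleHom (S : Subgroup (Equiv.Perm (Fin (p + 1)) × Equiv.Perm (Fin (p + 1)) ×
    Equiv.Perm (Fin (p + 1)))) : Type :=
  (kindTens (Y := Sylow p (Equiv.Perm (Fin (p + 1)))) (prodToPi₃ (Equiv.Perm (Fin (p + 1))))
    fun _ => .sumZero).functor S ⟶ atomicFunctor S (natRep₃ p)

/-- A coordinate of the value of a morphism at the Sylow subgroup `y` in all variables. -/
noncomputable def devCoord (y : Sylow p (Equiv.Perm (Fin (p + 1))))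
    (j : {j : Fin (p + 1) // j ≠ sylowPoint y}) : TripleHom (p := p) S →+ ZMod p where
  toFun α := (natBasis₃ (sylowPoint y)).repr (devVal α y y y) (j, j, j)
  map_zero' := by
    change (natBasis₃ (sylowPoint y)).repr 0 (j, j, j) = 0
    simp
  map_add' α β := by
    change (natBasis₃ (sylowPoint y)).repr (devVal α y y y + devVal β y y y) (j, j, j) = _
    rw [map_add, Finsupp.add_apply]

/-- The value at (y, y, y) is invariant under y × y × y, which acts transitively on the triples
indexing the basis. All its coordinates are therefore equal, and one of them determines the
morphism. -/
theorem devCoord_injective (y : Sylow p (Equiv.Perm (Fin (p + 1))))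
    (j : {j : Fin (p + 1) // j ≠ sylowPoint y}) :
    Function.Injective (devCoord (S := S) y j) := by
  rw [injective_iff_map_eq_zero]
  intro α hα
  have hcop : IsCoprime (Fintype.card (Sylow p (Equiv.Perm (Fin (p + 1)))) : ℤ) p := by
    rw [Nat.isCoprime_iff_coprime, Nat.coprime_comm, hp.out.coprime_iff_not_dvd,
      ← Nat.card_eq_fintype_card]
    exact not_dvd_card_sylow p _
  refine eq_zero_of_devVal zsmul_natMod₃ hcop (prodToPi₃_bijective _).2 y ?_
  apply (natBasis₃ (sylowPoint y)).repr.injective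
  rw [map_zero]
  ext ⟨a, b, c⟩
  obtain ⟨t₀, ht₀, h₀⟩ := exists_sylow_apply_eq y j.2 a.2
  obtain ⟨t₁, ht₁, h₁⟩ := exists_sylow_apply_eq y j.2 b.2
  obtain ⟨t₂, ht₂, h₂⟩ := exists_sylow_apply_eq y j.2 c.2
  have hy := (forall_smul_sylow_iff y.2 y).2 le_rfl
  have h := devVal_smul α (t₀, t₁, t₂) y y y
  have h' : devVal α y y y = natRep₃ p (t₀, t₁, t₂) (devVal α y y y) := by
    rw [← h]
    change _ = devVal α (t₀ • y) (t₁ • y) (t₂ • y)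
    rw [hy _ ht₀, hy _ ht₁, hy _ ht₂]
  rw [h', natBasis₃_repr_natRep₃ (apply_sylowPoint ht₀) (apply_sylowPoint ht₁)
    (apply_sylowPoint ht₂) h₀ h₁ h₂]
  exact hα

theorem pairing_prod₃ {Γ G Y V : Type} [Group Γ] [Group G] [Fintype Y] {k : Type} [CommRing k]
    [AddCommGroup V] [Module k V] (π : Γ →* (Fin 3 → G)) (e : Y → V)
    (u v w : Option Y × Option Y → ℤ) :
    pairing π (fun a b c => e a ⊗ₜ[k] (e b ⊗ₜ[k] e c)) (prod₃ π u v w) =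
      (∑ a, u (some a, none) • e a) ⊗ₜ[k]
        ((∑ b, v (some b, none) • e b) ⊗ₜ[k] (∑ c, w (some c, none) • e c)) := by
  rw [TensorProduct.sum_tmul]
  refine Finset.sum_congr rfl fun a _ => ?_
  rw [TensorProduct.sum_tmul, TensorProduct.tmul_sum]
  refine Finset.sum_congr rfl fun b _ => ?_
  rw [TensorProduct.tmul_sum, TensorProduct.tmul_sum]
  refine Finset.sum_congr rfl fun c _ => ?_
  simp only [TensorProduct.tmul_smul, ← TensorProduct.smul_tmul', smul_smul, prod₃, slots₃]
  congr 1
  simp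
  ring

/-- Take d = δ_y - δ_z, with y and z fixing distinct letters a and b. Its image is the class of e_a
- e_b, whose coordinate with base point a at a third letter l is 0 - 1; such a letter exists as p +
1 ≥ 3. -/
theorem exists_mem_sumZero_natCoord (y : Sylow p (Equiv.Perm (Fin (p + 1)))) :
    ∃ d ∈ (Kind.sumZero.lattice (Equiv.Perm (Fin (p + 1)))
      (Sylow p (Equiv.Perm (Fin (p + 1))))).sub, ∃ j,
      natCoord (sylowPoint y) (∑ a, d (some a, none) • sylowVec a) j = -1 := by
  classical
  obtain ⟨b, hb, -⟩ := exists_ne_ne hp.out (sylowPoint y) (sylowPoint y)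
  obtain ⟨l, hl, hlb⟩ := exists_ne_ne hp.out (sylowPoint y) b
  obtain ⟨z, hz⟩ : ∃ z, sylowPoint z = b :=
    ⟨Equiv.swap (sylowPoint y) b • y, by rw [sylowPoint_smul, Equiv.swap_apply_left]⟩
  refine ⟨fun t => (if t = (some y, none) then 1 else 0) - if t = (some z, none) then 1 else 0,
    Kind.mem_lattice.mpr ⟨?_, fun _ => ?_⟩, ⟨l, hl⟩, ?_⟩
  · rintro ⟨_ | b, _ | c⟩ h
    · simp at h
    · simp at h
    · simp [Kind.support]
    · simp at h
  · simp
  · have h : ∑ a, ((if ((some a, none) : Option (Sylow p (Equiv.Perm (Fin (p + 1)))) ×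
        Option (Sylow p (Equiv.Perm (Fin (p + 1))))) = (some y, none) then (1 : ℤ) else 0) -
        if ((some a, none) : Option (Sylow p (Equiv.Perm (Fin (p + 1)))) ×
        Option (Sylow p (Equiv.Perm (Fin (p + 1))))) = (some z, none) then 1 else 0) • sylowVec a =
        sylowVec y - sylowVec z := by
      simp [sub_smul, Finset.sum_sub_distrib, ite_smul]
    rw [h, map_sub, Pi.sub_apply, sylowVec, sylowVec, natCoord_mk, natCoord_mk, hz]
    simp [hl, hlb, hb.symm]

/-- The morphism given by pairing with the tensors of classes of Sylow subgroups. -/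
noncomputable def sylowHom (T : Sylow p (Equiv.Perm (Fin (p + 1)) ×
    Equiv.Perm (Fin (p + 1)) × Equiv.Perm (Fin (p + 1)))) : TripleHom (p := p) (T : Subgroup _) :=
  atomicHomOfEquivariant (pairing (prodToPi₃ (Equiv.Perm (Fin (p + 1)))) sylowVec₃)
    (pairing_comp_inv_smul natRep₃_sylowVec₃)
    (sumZero_eq_zero (prodToPi₃_bijective _).1 sylow_perm_inf_eq_bot)

/-- On d ⊗ d ⊗ d, with d from `exists_mem_sumZero_natCoord`, some coordinate of the value is (-1)³,
which is nonzero mod p. -/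
theorem sylowHom_ne_zero (T : Sylow p (Equiv.Perm (Fin (p + 1)) ×
    Equiv.Perm (Fin (p + 1)) × Equiv.Perm (Fin (p + 1)))) : sylowHom T ≠ 0 := by
  intro h
  obtain ⟨y⟩ : Nonempty (Sylow p (Equiv.Perm (Fin (p + 1)))) := inferInstance
  obtain ⟨d, hd, j, hj⟩ := exists_mem_sumZero_natCoord y
  have h1 : pairing (prodToPi₃ (Equiv.Perm (Fin (p + 1)))) sylowVec₃ (prod₃ (prodToPi₃ (Equiv.Perm (Fin (p + 1)))) d d d) = 0 := by
    have h2 := DFunLike.congr_fun (congrArg atomicHomVal h)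
      ⟨prod₃ (prodToPi₃ (Equiv.Perm (Fin (p + 1)))) d d d, PermLattice.mem_fixSub_bot (prod₃_mem hd hd hd)⟩
    rw [sylowHom, atomicHomVal_atomicHomOfEquivariant] at h2
    exact h2
  have h3 := pairing_prod₃ (k := ZMod p) (prodToPi₃ (Equiv.Perm (Fin (p + 1)))) sylowVec d d d
  have h4 := natBasis₃_repr_tmul (sylowPoint y) _ _ _ j j j |>.symm.trans
    (congrArg (fun m => (natBasis₃ (sylowPoint y)).repr m (j, j, j)) (h3.symm.trans h1))
  rw [hj] at h4
  simp at h4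

end Main

end

theorem mainTheorem3 (p : ℕ) [Fact p.Prime]
    (T : Sylow p (Equiv.Perm (Fin (p + 1)) × Equiv.Perm (Fin (p + 1)) ×
      Equiv.Perm (Fin (p + 1)))) :
    Nonempty
      (Lambda T (outerTensor (natRep p) (outerTensor (natRep p) (natRep p))) 3 ≃+ ZMod p) := by
  have := Fintype.ofFinite (Sylow p (Equiv.Perm (Fin (p + 1))))
  obtain ⟨y⟩ : Nonempty (Sylow p (Equiv.Perm (Fin (p + 1)))) := inferInstance
  obtain ⟨j, hj, -⟩ := exists_ne_ne (Fact.out : p.Prime) (sylowPoint y) (sylowPoint y)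
  obtain ⟨φ⟩ := higherLim_three_nonempty_addEquiv (T := T)
    (F := atomicFunctor (T : Subgroup _) (natRep₃ p)) (prodToPi₃_bijective _)
    dvd_card_perm sylow_perm_inf_eq_bot (zsmul_id_atomicFunctor zsmul_natMod₃)
    fun _ hQ => atomicFunctor_obj_eq_zero hQ
  let χ := devCoord (S := (T : Subgroup _)) y ⟨j, hj⟩
  have hχ : Function.Injective χ := devCoord_injective y ⟨j, hj⟩
  have hχ' : Function.Surjective χ := by
    have : Fact (Nat.card (ZMod p)).Prime := by
      rw [Nat.card_zmod]
      infer_instance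
    rw [← AddMonoidHom.range_eq_top]
    -- A group of prime order has no proper nontrivial subgroup, so one nonzero value suffices for
    -- surjectivity.
    refine (AddSubgroup.eq_bot_or_eq_top_of_prime_card (G := ZMod p) _).resolve_left fun h => ?_
    exact sylowHom_ne_zero T (hχ (by
      rw [map_zero, ← AddSubgroup.mem_bot, ← h]
      exact ⟨_, rfl⟩))
  exact ⟨φ.trans (AddEquiv.ofBijective χ ⟨hχ, hχ'⟩)⟩
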